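/- **Conventions.** All topological spaces are second countable, and $\mathfrak{A}_X$ denotes the Borel $\sigma$-algebra of $X$. Let $X,Y,A,B$ be compact Hausdorff spaces. An *information channel* $X\to A$ is a family $(p(\cdot|x))_{x\in X}$ of Borel probability measures on $A$ such that $x\mapsto p(\alpha|x)$ is Borel for every $\alpha\in\mathfrak{A}_A$. A *measurable no-signalling correlation* over $(X,Y,A,B)$ is an information channel $p: X\times Y\to A\times B$ such that $$p(\alpha\times B|x,y)=p(\alpha\times B|x,y')\quad\text{and}\quad p(A\times\beta|x,y)=p(A\times\beta|x',y)$$ for all $x,x'\in X$, $y,y'\in Y$, $\alpha\in\mathfrak{A}_A$, $\beta\in\mathfrak{A}_B$. A *quantum probability measure* on $A$ with values in $\mathcal{B}(H)$, $H$ a Hilbert space, is a map $E:\mathfrak{A}_A\to\mathcal{B}(H)^+$ with $E(A)=I$ that is countably additive in the weak* topology of $\mathcal{B}(H)$. An *operator-valued channel* $E:X\to(A;H)$ is a family $(E(\cdot|x))_{x\in X}$ of quantum probability measures on $A$ with values in $\mathcal{B}(H)$ such that $x\mapsto\langle E(\alpha|x)\xi,\eta\rangle$ is Borel for all $\alpha\in\mathfrak{A}_A$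 and $\xi,\eta\in H$. A measurable no-signalling correlation $p$ over $(X,Y,A,B)$ is * *local* ($p\in\mathcal{C}_{\rm loc}$) if there are $n\in\mathbb{N}$, information channels $q_i:X\to A$ and $r_i:Y\to B$, and $\lambda_i\in[0,1]$, $i=1,\dots,n$, with $\sum_{i=1}^n\lambda_i=1$ and $p(\cdot|x,y)=\sum_{i=1}^n\lambda_i\, q_i(\cdot|x)\times r_i(\cdot|y)$ for all $x\in X$, $y\in Y$; * *quantum spatial* ($p\in\mathcal{C}_{\rm qs}$) if there are Hilbert spaces $H,K$, operator-valued channels $E:X\to(A;H)$ and $F:Y\to(B;K)$ and a unit vector $\xi\in H\otimes K$ with $p(L|x,y)=\langle (E\otimes F)(L|x,y)\xi,\xi\rangle$ for all $x\in X$, $y\in Y$, $L\in\mathfrak{A}_{A\times B}$, where $(E\otimes F)(\cdot|x,y)$ is the quantum probability measure on $A\times B$ with $(E\otimes F)(\alpha\times\beta|x,y)=E(\alpha|x)\otimes F(\beta|y)$ for all $\alpha\in\mathfrak{A}_A$, $\beta\in\mathfrak{A}_B$; * *quantum commuting* ($p\in\mathcal{C}_{\rm qc}$) if there are a Hilbert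 space $H$, operator-valued channels $E:X\to(A;H)$ and $F:Y\to(B;H)$ with commuting ranges, and a unit vector $\xi\in H$ with $p(L|x,y)=\langle (E\cdot F)(L|x,y)\xi,\xi\rangle$ for all $x\in X$, $y\in Y$, $L\in\mathfrak{A}_{A\times B}$, where $(E\cdot F)(\cdot|x,y)$ is the quantum probability measure on $A\times B$ with $(E\cdot F)(\alpha\times\beta|x,y)=E(\alpha|x)F(\beta|y)$ for all $\alpha\in\mathfrak{A}_A$, $\beta\in\mathfrak{A}_B$. For $L_1\subseteq A_1\times B_1$ and $L_2\subseteq A_2\times B_2$ put $$L_1\dot\times L_2=\{((a_1,a_2),(b_1,b_2)) : (a_1,b_1)\in L_1,\ (a_2,b_2)\in L_2\}\subseteq (A_1\times A_2)\times(B_1\times B_2).$$ **Theorem.** Let $X_i,Y_i,A_i,B_i$ be compact Hausdorff spaces and let $p_i$ be a measurable no-signalling correlation over $(X_i,Y_i,A_i,B_i)$, $i=1,2$. (i) There is a unique measurable no-signalling correlation $p_1\otimes p_2$ over $(X_1\times X_2,\,Y_1\times Y_2,\,A_1\times A_2,\,B_1\times B_2)$ such that $$(p_1\otimes p_2)\big(L_1\dot\times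 L_2\,\big|\,(x_1,x_2),(y_1,y_2)\big)=p_1(L_1|x_1,y_1)\,p_2(L_2|x_2,y_2)$$ for all $L_i\in\mathfrak{A}_{A_i\times B_i}$, $x_i\in X_i$, $y_i\in Y_i$, $i=1,2$. (ii) Let ${\rm t}\in\{{\rm loc},{\rm qs},{\rm qc}\}$. If $p_1$ and $p_2$ both belong to $\mathcal{C}_{\rm t}$ (over their respective quadruples), then $p_1\otimes p_2\in\mathcal{C}_{\rm t}$. -/

import Mathlib

open MeasureTheory ProbabilityTheory Set
open scoped TensorProduct NNReal ENNReal

universe v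

noncomputable section

namespace MeasurableNS

/-! ### Quantum probability measures and operator-valued information channels -/

section Hilbert

variable {H : Type*} [NormedAddCommGroup H] [InnerProductSpace ℂ H]

/-- `∑ i, T i = S` in the weak* topology of `B(H)`, the dual of the trace class. The weak*
continuous functionals on `B(H)` are exactly the maps `T ↦ ∑ k, ⟨T ξₖ, ηₖ⟩` where
`∑ k, ‖ξₖ‖² < ∞` and `∑ k, ‖ηₖ‖² < ∞`. (Mathlib's inner product is linear in its second
argument, so `⟨T ξ, η⟩` is written `inner ℂ η (T ξ)`.) -/
def HasWeakStarSum (T : ℕ → H →L[ℂ] H) (S : H →L[ℂ] H) : Prop :=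
  ∀ ξ η : ℕ → H, Summable (fun k => ‖ξ k‖ ^ 2) → Summable (fun k => ‖η k‖ ^ 2) →
    HasSum (fun i => ∑' k, inner ℂ (η k) (T i (ξ k))) (∑' k, inner ℂ (η k) (S (ξ k)))

end Hilbert

/-- A quantum probability measure on the measurable space `A` with values in `B(H)`:
a positive-operator-valued, normalised, weak* countably additive function on the measurable sets.
(Its values on nonmeasurable sets are irrelevant.) -/
structure QPM (A : Type*) [MeasurableSpace A]
    (H : Type*) [NormedAddCommGroup H] [InnerProductSpace ℂ H] where
  toFun : Set A → H →L[ℂ] H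
  isPositive : ∀ α, MeasurableSet α → (toFun α).IsPositive
  univ_eq_one : toFun univ = 1
  iUnion : ∀ α : ℕ → Set A, (∀ i, MeasurableSet (α i)) → Pairwise (fun i j => Disjoint (α i) (α j)) →
    HasWeakStarSum (fun i => toFun (α i)) (toFun (⋃ i, α i))

instance (A : Type*) [MeasurableSpace A]
    (H : Type*) [NormedAddCommGroup H] [InnerProductSpace ℂ H] :
    CoeFun (QPM A H) (fun _ => Set A → H →L[ℂ] H) := ⟨QPM.toFun⟩

/-- An operator-valued information channel from `X` to `A` with values in `B(H)`: a weakly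
measurable family of quantum probability measures on `A`. -/
structure OpChannel (X A : Type*) [MeasurableSpace X] [MeasurableSpace A]
    (H : Type*) [NormedAddCommGroup H] [InnerProductSpace ℂ H] where
  toFun : X → QPM A H
  weaklyMeasurable : ∀ α, MeasurableSet α → ∀ ξ η : H,
    Measurable (fun x => inner ℂ η (toFun x α ξ))

instance (X A : Type*) [MeasurableSpace X] [MeasurableSpace A]
    (H : Type*) [NormedAddCommGroup H] [InnerProductSpace ℂ H] :
    CoeFun (OpChannel X A H) (fun _ => X → QPM A H) := ⟨OpChannel.toFun⟩

section Products

variable {X Y A B : Type*} [MeasurableSpace X] [MeasurableSpace Y]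
  [MeasurableSpace A] [MeasurableSpace B]
  {H K : Type*} [NormedAddCommGroup H] [InnerProductSpace ℂ H]
  [NormedAddCommGroup K] [InnerProductSpace ℂ K]

/-- The channels `E` and `F`, acting on the same space, have commuting ranges. -/
def CommutingRanges (E : OpChannel X A H) (F : OpChannel Y B H) : Prop :=
  ∀ x y α β, MeasurableSet α → MeasurableSet β → Commute (E x α) (F y β)

/-- `G` is the product family `E · F` of two channels with commuting ranges. For each `(x, y)` the
quantum probability measure `G (x, y)` is determined on measurable sets by this condition. -/
def IsDotProduct (E : OpChannel X A H) (F : OpChannel Y B H)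
    (G : X × Y → QPM (A × B) H) : Prop :=
  ∀ x y α β, MeasurableSet α → MeasurableSet β → G (x, y) (α ×ˢ β) = E x α * F y β

variable (H K) in
/-- The Hilbert space tensor product. -/
abbrev HilbertTensor : Type _ := UniformSpace.Completion (H ⊗[ℂ] K)

/-- The tensor product `S ⊗ T` of bounded operators, acting on the Hilbert space tensor product;
it is the bounded operator with `(S ⊗ T) (ξ ⊗ η) = S ξ ⊗ T η`. -/
def opTensor (S : H →L[ℂ] H) (T : K →L[ℂ] K) : HilbertTensor H K →L[ℂ] HilbertTensor H K :=
  (TensorProduct.mapL S T).completion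

/-- `G` is the tensor product family `E ⊗ F` of two channels. For each `(x, y)` the
quantum probability measure `G (x, y)` is determined on measurable sets by this condition. -/
def IsTensorProduct (E : OpChannel X A H) (F : OpChannel Y B K)
    (G : X × Y → QPM (A × B) (HilbertTensor H K)) : Prop :=
  ∀ x y α β, MeasurableSet α → MeasurableSet β →
    G (x, y) (α ×ˢ β) = opTensor (E x α) (F y β)

end Products

/-! ### Measurable no-signalling correlations -/

/-- A measurable no-signalling correlation over `(X, Y, A, B)`: an information channel (Markov
kernel) from `X × Y` to `A × B` whose `A`-marginal does not depend on `y` and whose `B`-marginal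
does not depend on `x`. -/
@[ext]
structure NSCorrelation (X Y A B : Type*) [MeasurableSpace X] [MeasurableSpace Y]
    [MeasurableSpace A] [MeasurableSpace B] where
  kernel : Kernel (X × Y) (A × B)
  isMarkov : IsMarkovKernel kernel
  left_marginal : ∀ x y y' α, MeasurableSet α →
    kernel (x, y) (α ×ˢ univ) = kernel (x, y') (α ×ˢ univ)
  right_marginal : ∀ x x' y β, MeasurableSet β →
    kernel (x, y) (univ ×ˢ β) = kernel (x', y) (univ ×ˢ β)

namespace NSCorrelation

variable {X Y A B : Type*} [MeasurableSpace X] [MeasurableSpace Y]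
  [MeasurableSpace A] [MeasurableSpace B]

/-- `p` is a finite convex combination of products of information channels `X → A` and `Y → B`. -/
def IsLocal (p : NSCorrelation X Y A B) : Prop :=
  ∃ (n : ℕ) (lam : Fin n → ℝ≥0) (q₁ : Fin n → Kernel X A) (q₂ : Fin n → Kernel Y B),
    (∀ i, IsMarkovKernel (q₁ i)) ∧ (∀ i, IsMarkovKernel (q₂ i)) ∧ ∑ i, lam i = 1 ∧
    ∀ x y, p.kernel (x, y) = ∑ i, lam i • (q₁ i x).prod (q₂ i y)

/-- `p` is the family of measures `L ↦ ⟨G(L | x, y) ξ, ξ⟩`. -/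
def IsVectorState {H : Type*} [NormedAddCommGroup H] [InnerProductSpace ℂ H]
    (p : NSCorrelation X Y A B) (G : X × Y → QPM (A × B) H) (ξ : H) : Prop :=
  ∀ x y L, MeasurableSet L → ((p.kernel (x, y)).real L : ℂ) = inner ℂ ξ (G (x, y) L ξ)

/-- `p = p_{E ⊗ F, ξ}` for channels `E : X → (A; H)` and `F : Y → (B; K)`, on Hilbert spaces
`H` and `K`, and a unit vector `ξ` in the Hilbert space tensor product of `H` and `K`. -/
def IsQuantumSpatial (p : NSCorrelation X Y A B) : Prop :=
  ∃ (H : Type v) (_ : NormedAddCommGroup H) (_ : InnerProductSpace ℂ H) (_ : CompleteSpace H)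
    (K : Type v) (_ : NormedAddCommGroup K) (_ : InnerProductSpace ℂ K) (_ : CompleteSpace K)
    (E : OpChannel X A H) (F : OpChannel Y B K)
    (G : X × Y → QPM (A × B) (HilbertTensor H K)) (ξ : HilbertTensor H K),
    IsTensorProduct E F G ∧ ‖ξ‖ = 1 ∧ p.IsVectorState G ξ

/-- `p = p_{E · F, ξ}` for channels `E : X → (A; H)` and `F : Y → (B; H)` with commuting ranges
on one Hilbert space `H` and a unit vector `ξ` in `H`. -/
def IsQuantumCommuting (p : NSCorrelation X Y A B) : Prop :=
  ∃ (H : Type v) (_ : NormedAddCommGroup H) (_ : InnerProductSpace ℂ H) (_ : CompleteSpace H)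
    (E : OpChannel X A H) (F : OpChannel Y B H)
    (G : X × Y → QPM (A × B) H) (ξ : H),
    CommutingRanges E F ∧ IsDotProduct E F G ∧ ‖ξ‖ = 1 ∧ p.IsVectorState G ξ

end NSCorrelation

/-- The set of all `((a, a'), (b, b'))` with `(a, b) ∈ L` and `(a', b') ∈ L'`. -/
def dotProd {A B A' B' : Type*} (L : Set (A × B)) (L' : Set (A' × B')) :
    Set ((A × A') × (B × B')) :=
  {z | (z.1.1, z.2.1) ∈ L ∧ (z.1.2, z.2.2) ∈ L'}

/-- `p` is multiplicative on the product sets `dotProd L₁ L₂`, with factors `p₁` and `p₂`. -/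
def IsCorrelationProduct
    {X₁ Y₁ A₁ B₁ X₂ Y₂ A₂ B₂ : Type*}
    [MeasurableSpace X₁] [MeasurableSpace Y₁] [MeasurableSpace A₁] [MeasurableSpace B₁]
    [MeasurableSpace X₂] [MeasurableSpace Y₂] [MeasurableSpace A₂] [MeasurableSpace B₂]
    (p₁ : NSCorrelation X₁ Y₁ A₁ B₁) (p₂ : NSCorrelation X₂ Y₂ A₂ B₂)
    (p : NSCorrelation (X₁ × X₂) (Y₁ × Y₂) (A₁ × A₂) (B₁ × B₂)) : Prop :=
  ∀ (x₁ : X₁) (x₂ : X₂) (y₁ : Y₁) (y₂ : Y₂) (L₁ : Set (A₁ × B₁)) (L₂ : Set (A₂ × B₂)),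
    MeasurableSet L₁ → MeasurableSet L₂ →
      p.kernel ((x₁, x₂), (y₁, y₂)) (dotProd L₁ L₂)
        = p₁.kernel (x₁, y₁) L₁ * p₂.kernel (x₂, y₂) L₂

end MeasurableNS

end

/-! For each pair of inputs the correlation product must be the product measure `p₁ × p₂`
transported along the interchange of the two middle coordinates. The interchange is an involution
carrying `dotProd` sets to rectangles, so existence, uniqueness and no-signalling reduce to facts
about product measures. The local case expands a product of two convex combinations.

The quantum cases need the tensor product of quantum probability measures (`QPM.prod`). Its matrix
coefficients on algebraic tensors are sums of products of complex measures. Positivity on rectangles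
comes from square roots, passes to all measurable sets by approximation (`nonneg_of_nonneg_prod`),
and turns each set into an operator by Riesz representation (`exists_operator_of_form`). For
positive operators, weak* additivity follows from scalar additivity on a dense subspace.

In the commuting case, `G₁ ⊗ G₂` with its coordinates interchanged is the product of `E₁ ⊗ E₂` and
`F₁ ⊗ F₂`, first on rectangles of rectangles, then everywhere (`QPM.apply_prod_eq_mul`). In the
spatial case the isometry `H₁ ⊗ K₁ ⊗ H₂ ⊗ K₂ → H₁ ⊗ H₂ ⊗ K₁ ⊗ K₂` moves the vector `ξ₁ ⊗ ξ₂` to the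
required space. -/

noncomputable section

namespace MeasurableNS

open scoped ComplexOrder ComplexConjugate

/-! ### Complex measures on products: positivity and uniqueness from rectangles. -/

section ComplexMeasure

variable {A B : Type*} [MeasurableSpace A] [MeasurableSpace B]

/-- The total variations of the real and imaginary parts are finite and dominate. Finiteness is what
permits approximation of measurable sets in variation. -/
instance isFiniteMeasure_variation_complexMeasure (c : ComplexMeasure A) :
    IsFiniteMeasure c.variation := by
  have h : c.variation ≤
      (ComplexMeasure.re c).totalVariation + (ComplexMeasure.im c).totalVariation := by
    refine VectorMeasure.variation_le_of_forall_enorm_le fun E _ => ?_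
    have h1 := SignedMeasure.enorm_le_totalVariation (ComplexMeasure.re c) E
    have h2 := SignedMeasure.enorm_le_totalVariation (ComplexMeasure.im c) E
    calc ‖c E‖ₑ = ‖((c E).re : ℂ) + (c E).im * Complex.I‖ₑ := by rw [Complex.re_add_im]
      _ ≤ ‖((c E).re : ℂ)‖ₑ + ‖(c E).im * Complex.I‖ₑ := enorm_add_le _ _
      _ = ‖(c E).re‖ₑ + ‖(c E).im‖ₑ := by
        simp [enorm_eq_nnnorm]
      _ ≤ _ := add_le_add h1 h2
  exact isFiniteMeasure_of_le _ h

/-- The sets that are determined by the values of one measurable map with finitely many values on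
each of the two coordinates. -/
def finiteGridSets (A B : Type*) [MeasurableSpace A] [MeasurableSpace B] : Set (Set (A × B)) :=
  {R | ∃ (n m : ℕ) (f : A → Fin n) (g : B → Fin m) (S : Set (Fin n × Fin m)),
    Measurable f ∧ Measurable g ∧ R = Prod.map f g ⁻¹' S}

theorem isSetAlgebra_finiteGridSets : IsSetAlgebra (finiteGridSets A B) where
  empty_mem := ⟨1, 1, fun _ => 0, fun _ => 0, ∅, measurable_const, measurable_const, by simp⟩
  compl_mem := by
    rintro _ ⟨n, m, f, g, S, hf, hg, rfl⟩
    exact ⟨n, m, f, g, Sᶜ, hf, hg, by simp⟩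
  union_mem := by
    rintro _ _ ⟨n, m, f, g, S, hf, hg, rfl⟩ ⟨n', m', f', g', S', hf', hg', rfl⟩
    -- The common refinement of the two grids is given by the pairs `(f, f')` and `(g, g')`.
    let e : Fin n × Fin n' ≃ Fin (n * n') := finProdFinEquiv
    let e' : Fin m × Fin m' ≃ Fin (m * m') := finProdFinEquiv
    refine ⟨n * n', m * m', fun a => e (f a, f' a), fun b => e' (g b, g' b),
      {z | ((e.symm z.1).1, (e'.symm z.2).1) ∈ S ∨ ((e.symm z.1).2, (e'.symm z.2).2) ∈ S'},
      (measurable_of_countable e).comp (hf.prodMk hf'),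
      (measurable_of_countable e').comp (hg.prodMk hg'), ?_⟩
    ext ⟨a, b⟩
    simp

theorem measurableSet_of_mem_finiteGridSets {R : Set (A × B)} (hR : R ∈ finiteGridSets A B) :
    MeasurableSet R := by
  obtain ⟨n, m, f, g, S, hf, hg, rfl⟩ := hR
  exact (hf.prodMap hg) S.toFinite.measurableSet

theorem prod_mem_finiteGridSets {α : Set A} {β : Set B} (hα : MeasurableSet α)
    (hβ : MeasurableSet β) : α ×ˢ β ∈ finiteGridSets A B := by
  classical
  refine ⟨2, 2, fun a => if a ∈ α then 1 else 0, fun b => if b ∈ β then 1 else 0, {(1, 1)},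
    Measurable.ite hα measurable_const measurable_const,
    Measurable.ite hβ measurable_const measurable_const, ?_⟩
  ext ⟨a, b⟩
  by_cases ha : a ∈ α <;> by_cases hb : b ∈ β <;> simp [ha, hb]

theorem generateFrom_finiteGridSets :
    (inferInstance : MeasurableSpace (A × B)) =
      MeasurableSpace.generateFrom (finiteGridSets A B) := by
  refine le_antisymm ?_ (MeasurableSpace.generateFrom_le fun R hR =>
    measurableSet_of_mem_finiteGridSets hR)
  change Prod.instMeasurableSpace ≤ _
  rw [← generateFrom_prod]
  refine MeasurableSpace.generateFrom_mono ?_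
  rintro _ ⟨α, hα, β, hβ, rfl⟩
  exact prod_mem_finiteGridSets hα hβ

/-- A grid set is a finite disjoint union of measurable rectangles, its cells. -/
theorem nonneg_of_mem_finiteGridSets {c : ComplexMeasure (A × B)}
    (hc : ∀ α β, MeasurableSet α → MeasurableSet β → 0 ≤ c (α ×ˢ β))
    {R : Set (A × B)} (hR : R ∈ finiteGridSets A B) : 0 ≤ c R := by
  classical
  obtain ⟨n, m, f, g, S, hf, hg, rfl⟩ := hR
  have h : Prod.map f g ⁻¹' S =
      ⋃ z ∈ Finset.univ.filter (· ∈ S), (f ⁻¹' {z.1}) ×ˢ (g ⁻¹' {z.2}) := by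
    ext ⟨a, b⟩
    simp
  rw [h, VectorMeasure.of_biUnion_finset]
  · exact Finset.sum_nonneg fun z _ => hc _ _ (hf (measurableSet_singleton _))
      (hg (measurableSet_singleton _))
  · rintro ⟨i, j⟩ _ ⟨i', j'⟩ _ hne
    refine Set.disjoint_left.2 ?_
    rintro ⟨a, b⟩ ⟨h1, h2⟩ ⟨h3, h4⟩
    simp only [mem_preimage, mem_singleton_iff] at h1 h2 h3 h4
    exact hne (by rw [← h1, ← h2, ← h3, ← h4])
  · exact fun z _ => (hf (measurableSet_singleton _)).prod (hg (measurableSet_singleton _))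

/-- The contributions of `s ∩ t` cancel. -/
theorem norm_sub_le_variation_symmDiff (c : ComplexMeasure A) {s t : Set A}
    (hs : MeasurableSet s) (ht : MeasurableSet t) :
    ‖c s - c t‖ ≤ c.variation.real (symmDiff s t) := by
  have h1 : c s = c (s ∩ t) + c (s \ t) := by
    rw [← VectorMeasure.of_union (disjoint_sdiff_right.mono_left inter_subset_right)
      (hs.inter ht) (hs.diff ht), inter_union_sdiff]
  have h2 : c t = c (s ∩ t) + c (t \ s) := by
    rw [← VectorMeasure.of_union (disjoint_sdiff_right.mono_left inter_subset_left)
      (hs.inter ht) (ht.diff hs), inter_comm, inter_union_sdiff]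
  have h3 : c.variation.real (symmDiff s t)
      = c.variation.real (s \ t) + c.variation.real (t \ s) := by
    rw [Set.symmDiff_def, measureReal_union disjoint_sdiff_sdiff (ht.diff hs)]
  rw [h1, h2, add_sub_add_left_eq_sub, h3]
  exact (norm_sub_le _ _).trans (add_le_add
    (VectorMeasure.norm_measure_le_variation (measure_ne_top _ _))
    (VectorMeasure.norm_measure_le_variation (measure_ne_top _ _)))

/-- A complex measure on a product which is nonnegative on the measurable rectangles is
nonnegative. -/
theorem nonneg_of_nonneg_prod {c : ComplexMeasure (A × B)}
    (hc : ∀ α β, MeasurableSet α → MeasurableSet β → 0 ≤ c (α ×ˢ β)) (L : Set (A × B)) :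
    0 ≤ c L := by
  by_cases hL : MeasurableSet L
  swap
  · rw [c.not_measurable hL]
  have hd := Measure.MeasureDense.of_generateFrom_isSetAlgebra_finite (μ := c.variation)
    isSetAlgebra_finiteGridSets (generateFrom_finiteGridSets (A := A) (B := B))
  -- `c L` is a limit of values `c R` on grid sets `R` approximating `L` in variation, and the
  -- nonnegative cone is closed.
  have hcl : IsClosed {z : ℂ | 0 ≤ z} := isClosed_le continuous_const continuous_id
  refine hcl.closure_subset (Metric.mem_closure_iff.2 fun ε hε => ?_)
  obtain ⟨R, hR, h⟩ := hd.approx L hL (measure_ne_top _ _) ε hε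
  refine ⟨c R, nonneg_of_mem_finiteGridSets hc hR, ?_⟩
  rw [dist_eq_norm]
  refine (norm_sub_le_variation_symmDiff c hL (measurableSet_of_mem_finiteGridSets hR)).trans_lt ?_
  rw [Measure.real, ← ENNReal.lt_ofReal_iff_toReal_lt (measure_ne_top _ _)]
  exact h

/-- Two complex measures on a product which agree on the measurable rectangles are equal. -/
theorem complexMeasure_ext_prod {c d : ComplexMeasure (A × B)}
    (h : ∀ α β, MeasurableSet α → MeasurableSet β → c (α ×ˢ β) = d (α ×ˢ β)) : c = d := by
  refine VectorMeasure.ext_of_generateFrom _ ?_ generateFrom_prod.symm isPiSystem_prod ?_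
  · rintro _ ⟨α, hα, β, hβ, rfl⟩
    exact h α β hα hβ
  · rw [← univ_prod_univ]
    exact h _ _ .univ .univ

end ComplexMeasure

/-! ### Quantum probability measures through their scalar measures. -/

section QPM

variable {A B : Type*} [MeasurableSpace A] [MeasurableSpace B]
  {H : Type*} [NormedAddCommGroup H] [InnerProductSpace ℂ H]

/-- Polarisation: positivity at `η ± ξ` and `η ± i ξ` bounds the real and imaginary parts. The bound
is additive in the two diagonal terms, so limits and summability pass from diagonal to mixed terms.
-/
theorem norm_inner_le_of_isPositive {T : H →L[ℂ] H} (hT : T.IsPositive) (ξ η : H) :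
    ‖inner ℂ η (T ξ)‖ ≤ (inner ℂ η (T η)).re + (inner ℂ ξ (T ξ)).re := by
  have h0 : ∀ ζ, 0 ≤ (inner ℂ ζ (T ζ)).re := fun ζ =>
    (Complex.nonneg_iff.1 (hT.inner_nonneg_right ζ)).1
  have hsymm : inner ℂ ξ (T η) = conj (inner ℂ η (T ξ)) := by
    rw [inner_conj_symm]
    exact (hT.isSymmetric ξ η).symm
  have e1 := h0 (η + ξ)
  have e2 := h0 (η - ξ)
  have e3 := h0 (η + Complex.I • ξ)
  have e4 := h0 (η - Complex.I • ξ)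
  simp only [map_add, map_sub, map_smul, inner_add_left, inner_add_right, inner_sub_left,
    inner_sub_right, inner_smul_left, inner_smul_right, hsymm, Complex.add_re, Complex.sub_re,
    Complex.mul_re, Complex.conj_re, Complex.conj_im, Complex.conj_I, Complex.I_re, Complex.I_im,
    Complex.neg_re, Complex.neg_im, Complex.mul_im,
    Complex.add_im, Complex.sub_im] at e1 e2 e3 e4
  refine (Complex.norm_le_abs_re_add_abs_im _).trans ?_
  have h1 : |(inner ℂ η (T ξ)).re| ≤ ((inner ℂ η (T η)).re + (inner ℂ ξ (T ξ)).re) / 2 :=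
    abs_le.2 ⟨by linarith, by linarith⟩
  have h2 : |(inner ℂ η (T ξ)).im| ≤ ((inner ℂ η (T η)).re + (inner ℂ ξ (T ξ)).re) / 2 :=
    abs_le.2 ⟨by linarith, by linarith⟩
  linarith

/-- For positive operators, weak* convergence of a series follows from weak convergence. -/
theorem hasWeakStarSum_of_hasSum_inner {T : ℕ → H →L[ℂ] H} {S : H →L[ℂ] H}
    (hT : ∀ i, (T i).IsPositive)
    (h : ∀ ξ η : H, HasSum (fun i => inner ℂ η (T i ξ)) (inner ℂ η (S ξ))) :
    HasWeakStarSum T S := by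
  intro ξ η hξ hη
  have hre : ∀ ζ : H, HasSum (fun i => (inner ℂ ζ (T i ζ)).re) (inner ℂ ζ (S ζ)).re := fun ζ =>
    Complex.hasSum_re (h ζ ζ)
  have hS : ∀ ζ : H, ‖inner ℂ ζ (S ζ)‖ ≤ ‖S‖ * ‖ζ‖ ^ 2 := fun ζ => by
    refine (norm_inner_le_norm _ _).trans ?_
    nlinarith [S.le_opNorm ζ, norm_nonneg ζ]
  -- Diagonal terms are nonnegative, so Tonelli applies: summing over the operators first gives at
  -- most `‖S‖ ‖ζ k‖²`. Mixed terms are then absolutely summable and the two sums may be exchanged.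
  have hsq : ∀ ζ : ℕ → H, Summable (fun k => ‖ζ k‖ ^ 2) →
      Summable fun p : ℕ × ℕ => (inner ℂ (ζ p.1) (T p.2 (ζ p.1))).re := by
    intro ζ hζ
    have h0 : 0 ≤ fun p : ℕ × ℕ => (inner ℂ (ζ p.1) (T p.2 (ζ p.1))).re := fun p =>
      (Complex.nonneg_iff.1 ((hT p.2).inner_nonneg_right (ζ p.1))).1
    rw [summable_prod_of_nonneg h0]
    refine ⟨fun k => (hre (ζ k)).summable, ?_⟩
    refine Summable.of_norm_bounded (hζ.mul_left ‖S‖) fun k => ?_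
    rw [(hre (ζ k)).tsum_eq]
    exact (Complex.abs_re_le_norm _).trans (hS _)
  have hsum : Summable fun p : ℕ × ℕ => inner ℂ (η p.1) (T p.2 (ξ p.1)) :=
    Summable.of_norm_bounded ((hsq η hη).add (hsq ξ hξ)) fun p =>
      norm_inner_le_of_isPositive (hT p.2) _ _
  have h1 : HasSum (fun k => inner ℂ (η k) (S (ξ k)))
      (∑' p : ℕ × ℕ, inner ℂ (η p.1) (T p.2 (ξ p.1))) :=
    hsum.hasSum.prod_fiberwise fun k => h (ξ k) (η k)
  rw [h1.tsum_eq]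
  have h2 := (Equiv.prodComm ℕ ℕ).summable_iff.2 hsum
  have h3 := ((Equiv.prodComm ℕ ℕ).hasSum_iff.2 hsum.hasSum).prod_fiberwise
    fun i => (h2.prod_factor i).hasSum
  exact h3

namespace QPM

theorem hasSum_inner (E : QPM A H) (ξ η : H) {α : ℕ → Set A} (hα : ∀ i, MeasurableSet (α i))
    (hd : Pairwise (fun i j => Disjoint (α i) (α j))) :
    HasSum (fun i => inner ℂ η (E (α i) ξ)) (inner ℂ η (E (⋃ i, α i) ξ)) := by
  -- Sequences supported at index `0` reduce weak* functionals to single matrix coefficients.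
  have hs : ∀ ζ : H, Summable fun k : ℕ => ‖if k = 0 then ζ else 0‖ ^ 2 := fun ζ =>
    summable_of_ne_finset_zero (s := {0}) fun k hk => by
      simp [show k ≠ 0 by simpa using hk]
  have h := E.iUnion α hα hd _ _ (hs ξ) (hs η)
  have ht : ∀ T : H →L[ℂ] H,
      (∑' k : ℕ, inner ℂ (if k = 0 then η else 0) (T (if k = 0 then ξ else 0)))
        = inner ℂ η (T ξ) := fun T => by
    rw [tsum_eq_single 0 fun k hk => by simp [hk]]
    simp
  simpa only [ht] using h

theorem inner_empty (E : QPM A H) (ξ η : H) : inner ℂ η (E ∅ ξ) = 0 := by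
  have h := E.hasSum_inner ξ η (α := fun _ => ∅) (fun _ => .empty) (fun _ _ _ => disjoint_bot_left)
  exact (summable_const_iff _).1 h.summable

open Classical in
/-- The complex measure `α ↦ ⟨E(α) ξ, η⟩`. -/
def complexMeasure (E : QPM A H) (ξ η : H) : ComplexMeasure A where
  measureOf' α := if MeasurableSet α then inner ℂ η (E α ξ) else 0
  empty' := by simp [E.inner_empty]
  not_measurable' α hα := by simp [hα]
  m_iUnion' α hα hd := by
    simpa [hα, MeasurableSet.iUnion hα] using E.hasSum_inner ξ η hα hd

theorem complexMeasure_apply (E : QPM A H) (ξ η : H) {α : Set A} (hα : MeasurableSet α) :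
    E.complexMeasure ξ η α = inner ℂ η (E α ξ) := by
  simp [complexMeasure, hα]

/-- The image of a quantum probability measure under a measurable map. -/
def map (E : QPM A H) {f : A → B} (hf : Measurable f) : QPM B H where
  toFun β := E (f ⁻¹' β)
  isPositive β hβ := E.isPositive _ (hf hβ)
  univ_eq_one := E.univ_eq_one
  iUnion β hβ hd := by
    rw [preimage_iUnion]
    exact E.iUnion _ (fun i => hf (hβ i)) fun i j hij => (hd hij).preimage f

theorem map_apply (E : QPM A H) {f : A → B} (hf : Measurable f) (β : Set B) :
    E.map hf β = E (f ⁻¹' β) := rfl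

theorem apply_compl (E : QPM A H) {α : Set A} (hα : MeasurableSet α) : E αᶜ = 1 - E α := by
  refine ContinuousLinearMap.ext fun ξ => ext_inner_left ℂ fun η => ?_
  have h := VectorMeasure.of_compl (v := E.complexMeasure ξ η) hα
  rw [complexMeasure_apply _ _ _ hα.compl, complexMeasure_apply _ _ _ hα,
    complexMeasure_apply _ _ _ .univ, E.univ_eq_one] at h
  simpa [inner_sub_right] using h

end QPM

end QPM

end MeasurableNS

namespace MeasurableNS

open scoped ComplexOrder ComplexConjugate
open UniformSpace

/-! ### Operators on a completion, built and tested on the dense subspace. -/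

section Completion

variable {D : Type*} [NormedAddCommGroup D] [InnerProductSpace ℂ D]

theorem isPositive_completion {T : Completion D →L[ℂ] Completion D}
    (h : ∀ u : D, 0 ≤ inner ℂ (u : Completion D) (T u)) : T.IsPositive := by
  have h' : ∀ ξ, 0 ≤ inner ℂ ξ (T ξ) := fun ξ =>
    Completion.induction_on ξ
      (isClosed_le continuous_const (continuous_id.inner T.continuous)) h
  rw [ContinuousLinearMap.isPositive_iff_complex]
  intro ξ
  have h1 := Complex.nonneg_iff.1 (h' ξ)
  rw [← inner_conj_symm (T ξ) ξ, RCLike.conj_re]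
  refine ⟨?_, h1.1⟩
  apply Complex.ext
  · exact (Complex.ofReal_re _).trans (Complex.conj_re _).symm
  · rw [Complex.conj_im, ← h1.2, neg_zero]
    exact Complex.ofReal_im _

theorem ext_inner_completion {S T : Completion D →L[ℂ] Completion D}
    (h : ∀ u v : D, inner ℂ (v : Completion D) (S u) = inner ℂ (v : Completion D) (T u)) :
    S = T := by
  refine ContinuousLinearMap.ext fun ξ => ext_inner_left ℂ fun η => ?_
  exact Completion.induction_on₂ ξ η
    (isClosed_eq (continuous_snd.inner (S.continuous.comp continuous_fst))
      (continuous_snd.inner (T.continuous.comp continuous_fst))) h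

/-- A bounded positive form on a pre-Hilbert space is given by an operator on the completion. -/
theorem exists_operator_of_form (b : D → D → ℂ)
    (hadd : ∀ u u' v, b (u + u') v = b u v + b u' v)
    (hsmul : ∀ (a : ℂ) u v, b (a • u) v = a * b u v)
    (hsymm : ∀ u v, conj (b u v) = b v u)
    (hpos : ∀ u, 0 ≤ b u u) (hle : ∀ u, (b u u).re ≤ ‖u‖ ^ 2) :
    ∃ T : Completion D →L[ℂ] Completion D,
      ∀ u v : D, inner ℂ (v : Completion D) (T u) = b u v := by
  have hcs : ∀ u v, ‖b u v‖ ≤ ‖u‖ * ‖v‖ := by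
    -- Cauchy–Schwarz for `b` itself. The arguments are swapped because `b` is linear in its first
    -- slot and `inner` in its second.
    let core : PreInnerProductSpace.Core ℂ D :=
      { inner := fun x y => b y x
        conj_inner_symm := fun x y => hsymm _ _
        re_inner_nonneg := fun x => (Complex.nonneg_iff.1 (hpos x)).1
        add_left := fun x y z => by
          change b z (x + y) = b z x + b z y
          rw [← hsymm, hadd, map_add, hsymm, hsymm]
        smul_left := fun x y r => by
          change b y (r • x) = conj r * b y x
          rw [← hsymm, hsmul, map_mul, hsymm] }
    intro u v
    have h := @InnerProductSpace.Core.inner_mul_inner_self_le ℂ D _ _ _ core v u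
    have h1 : ‖b u v‖ * ‖b v u‖ ≤ (b v v).re * (b u u).re := h
    rw [← hsymm u v, RCLike.norm_conj] at h1
    refine abs_le_of_sq_le_sq' (b := ‖u‖ * ‖v‖) ?_ (by positivity) |>.2
    have h2 := mul_le_mul (hle v) (hle u) (Complex.nonneg_iff.1 (hpos u)).1 (by positivity)
    nlinarith
  let φ : D → D →L[ℂ] ℂ := fun u => LinearMap.mkContinuous
    { toFun := fun v => b v u
      map_add' := fun v v' => hadd v v' u
      map_smul' := fun a v => hsmul a v u } ‖u‖ fun v => by
        rw [mul_comm]; exact hcs v u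
  -- The Riesz vector of `v ↦ b v u`; the operator sought is the extension of `u ↦ w u`.
  let w : D → Completion D := fun u =>
    (InnerProductSpace.toDual ℂ (Completion D)).symm (φ u).fromCompletion
  have hw : ∀ u v : D, inner ℂ (w u) (v : Completion D) = b v u := fun u v => by
    simp only [w, InnerProductSpace.toDual_symm_apply,
      ContinuousLinearMap.fromCompletion_apply_coe]
    rfl
  have hw' : ∀ u v : D, inner ℂ (v : Completion D) (w u) = b u v := fun u v => by
    rw [← inner_conj_symm, hw, hsymm]
  have hext : ∀ x y : Completion D,
      (∀ v : D, inner ℂ (v : Completion D) x = inner ℂ (v : Completion D) y) → x = y :=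
    fun x y h => ext_inner_left ℂ fun η => Completion.induction_on η
      (isClosed_eq (continuous_id.inner continuous_const)
        (continuous_id.inner continuous_const)) h
  have hnorm : ∀ u, ‖w u‖ ≤ 1 * ‖u‖ := fun u => by
    have h1 : ∀ x : Completion D, ‖inner ℂ (w u) x‖ ≤ ‖u‖ * ‖x‖ := fun x =>
      Completion.induction_on x
        (isClosed_le (continuous_const.inner continuous_id).norm
          (continuous_const.mul continuous_norm)) fun v => by
        rw [hw, mul_comm, Completion.norm_coe]
        exact hcs v u
    have h2 := h1 (w u)
    rw [inner_self_eq_norm_sq_to_K, norm_pow, RCLike.norm_ofReal, abs_norm, sq] at h2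
    rw [one_mul]
    by_contra! h3
    have := lt_of_le_of_lt (norm_nonneg u) h3
    nlinarith
  let W : D →L[ℂ] Completion D := LinearMap.mkContinuous
    { toFun := w
      map_add' := fun u u' => hext _ _ fun v => by
        rw [inner_add_right, hw', hw', hw', hadd]
      map_smul' := fun a u => hext _ _ fun v => by
        rw [RingHom.id_apply, inner_smul_right, hw', hw', hsmul] } 1 hnorm
  refine ⟨W.fromCompletion, fun u v => ?_⟩
  rw [ContinuousLinearMap.fromCompletion_apply_coe]
  exact hw' u v

/-- Parallelogram law for the form of `T` at `u` and `ξ - u`, dropping the nonnegative term at `2u -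
ξ`. -/
theorem inner_le_two_mul_of_isPositive {T : D →L[ℂ] D} (hT : T.IsPositive) (ξ u : D) :
    (inner ℂ ξ (T ξ)).re ≤ 2 * (inner ℂ u (T u)).re + 2 * (inner ℂ (ξ - u) (T (ξ - u))).re := by
  have h := (Complex.nonneg_iff.1 (hT.inner_nonneg_right ((2 : ℂ) • u - ξ))).1
  have h2 : (conj (2 : ℂ)) = 2 := Complex.conj_ofReal 2
  simp only [map_sub, map_smul, inner_sub_left, inner_sub_right, inner_smul_left,
    inner_smul_right, Complex.sub_re, h2, Complex.re_ofNat, Complex.im_ofNat, Complex.mul_re] at h ⊢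
  linarith

/-- Weak convergence of a series of positive operators can be tested on a dense subspace. -/
theorem hasSum_inner_completion {T : ℕ → Completion D →L[ℂ] Completion D}
    {S : Completion D →L[ℂ] Completion D} (hT : ∀ i, (T i).IsPositive)
    (h : ∀ u : D, HasSum (fun i => inner ℂ (u : Completion D) (T i u))
      (inner ℂ (u : Completion D) (S u))) (ξ η : Completion D) :
    HasSum (fun i => inner ℂ η (T i ξ)) (inner ℂ η (S ξ)) := by
  -- The remainders are positive and their forms are dominated by `‖S‖ ‖ζ‖²` uniformly in `s`; this
  -- uniformity lets convergence pass from the dense subspace to the completion.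
  let R : Finset ℕ → Completion D →L[ℂ] Completion D := fun s => S - ∑ i ∈ s, T i
  have hR : ∀ s ξ η, inner ℂ η (R s ξ) = inner ℂ η (S ξ) - ∑ i ∈ s, inner ℂ η (T i ξ) := by
    intro s ξ η
    simp [R, inner_sub_right, inner_sum]
  have hpos : ∀ s, (R s).IsPositive := fun s => isPositive_completion fun u => by
    rw [hR, sub_nonneg]
    exact sum_le_hasSum s (fun i _ => (hT i).inner_nonneg_right _) (h u)
  have hRS : ∀ s ζ, (inner ℂ ζ (R s ζ)).re ≤ ‖S‖ * ‖ζ‖ ^ 2 := by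
    intro s ζ
    have h1 : (inner ℂ ζ (R s ζ)).re ≤ (inner ℂ ζ (S ζ)).re := by
      rw [hR, Complex.sub_re, Complex.re_sum]
      have : 0 ≤ ∑ i ∈ s, (inner ℂ ζ (T i ζ)).re := Finset.sum_nonneg fun i _ =>
        (Complex.nonneg_iff.1 ((hT i).inner_nonneg_right ζ)).1
      linarith
    refine h1.trans ((Complex.re_le_norm _).trans ((norm_inner_le_norm _ _).trans ?_))
    nlinarith [S.le_opNorm ζ, norm_nonneg ζ]
  have key : ∀ ξ, Filter.Tendsto (fun s => (inner ℂ ξ (R s ξ)).re) Filter.atTop (nhds 0) := by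
    intro ξ
    rw [Metric.tendsto_nhds]
    intro ε hε
    have hc : Filter.Tendsto (fun u : Completion D => 2 * (‖S‖ * ‖ξ - u‖ ^ 2)) (nhds ξ)
        (nhds 0) := by
      have : Continuous fun u : Completion D => 2 * (‖S‖ * ‖ξ - u‖ ^ 2) := by fun_prop
      simpa using this.tendsto ξ
    -- Replacing `ξ` by `x` costs less than `ε / 2` for every `s`; the remaining term, doubled,
    -- needs `ε / 4`.
    obtain ⟨x, hx⟩ := (Completion.denseRange_coe (α := D)).exists_mem_open
      (isOpen_interior (s := {u : Completion D | 2 * (‖S‖ * ‖ξ - u‖ ^ 2) < ε / 2}))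
      ⟨ξ, mem_interior_iff_mem_nhds.2 (hc.eventually_lt_const (by positivity))⟩
    replace hx := interior_subset hx
    have hu : Filter.Tendsto (fun s => (inner ℂ (x : Completion D) (R s x)).re) Filter.atTop
        (nhds 0) := by
      have h1 : Filter.Tendsto (fun s : Finset ℕ => inner ℂ (x : Completion D) (R s x))
          Filter.atTop (nhds 0) := by
        have h2 := (tendsto_const_nhds (x := inner ℂ (x : Completion D) (S x))).sub (h x)
        rw [sub_self] at h2
        refine h2.congr fun s => (hR s _ _).symm
      exact Complex.zero_re ▸ (Complex.continuous_re.tendsto 0).comp h1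
    filter_upwards [hu.eventually_lt_const (show (0 : ℝ) < ε / 4 by positivity)] with s hs
    have h0 := (Complex.nonneg_iff.1 ((hpos s).inner_nonneg_right ξ)).1
    rw [Real.dist_eq, sub_zero, abs_of_nonneg h0]
    have h1 := inner_le_two_mul_of_isPositive (hpos s) ξ x
    have h2 := hRS s (ξ - x)
    have hx' : 2 * (‖S‖ * ‖ξ - x‖ ^ 2) < ε / 2 := hx
    linarith
  have hlim : Filter.Tendsto (fun s => inner ℂ η (R s ξ)) Filter.atTop (nhds 0) := by
    refine squeeze_zero_norm (fun s => norm_inner_le_of_isPositive (hpos s) ξ η) ?_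
    simpa using (key η).add (key ξ)
  have := (tendsto_const_nhds (x := inner ℂ η (S ξ))).sub hlim
  rw [sub_zero] at this
  refine this.congr fun s => ?_
  rw [hR, sub_sub_cancel]

end Completion

/-! ### Tensor products of bounded operators. -/

section OpTensor

variable {H K : Type*} [NormedAddCommGroup H] [InnerProductSpace ℂ H]
  [NormedAddCommGroup K] [InnerProductSpace ℂ K]

theorem opTensor_coe (S : H →L[ℂ] H) (T : K →L[ℂ] K) (u : H ⊗[ℂ] K) :
    opTensor S T (u : HilbertTensor H K) = (TensorProduct.mapL S T u : H ⊗[ℂ] K) :=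
  ContinuousLinearMap.completion_apply_coe _ _

theorem opTensor_one : opTensor (1 : H →L[ℂ] H) (1 : K →L[ℂ] K) = 1 := by
  refine ext_inner_completion fun u v => ?_
  rw [opTensor_coe]
  congr 2
  exact congrArg (· u) (TensorProduct.mapL_id_id (𝕜 := ℂ) (E := H) (G := K))

theorem opTensor_mul (S S' : H →L[ℂ] H) (T T' : K →L[ℂ] K) :
    opTensor (S * S') (T * T') = opTensor S T * opTensor S' T' := by
  refine ext_inner_completion fun u v => ?_
  rw [mul_apply_eq_comp, opTensor_coe, opTensor_coe, opTensor_coe,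
    TensorProduct.mapL_mul, mul_apply_eq_comp]

theorem inner_mapL_left {S S' : H →L[ℂ] H} {T T' : K →L[ℂ] K}
    (hS : ∀ x y, inner ℂ (S x) y = inner ℂ x (S' y))
    (hT : ∀ x y, inner ℂ (T x) y = inner ℂ x (T' y)) (u v : H ⊗[ℂ] K) :
    inner ℂ (TensorProduct.mapL S T u) v = inner ℂ u (TensorProduct.mapL S' T' v) := by
  induction u with
  | zero => simp
  | add u u' h h' => rw [map_add, inner_add_left, h, h', inner_add_left]
  | tmul x y =>
    induction v with
    | zero => simp
    | add v v' h h' => rw [map_add, inner_add_right, h, h', inner_add_right]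
    | tmul x' y' =>
      simp only [TensorProduct.mapL_tmul, TensorProduct.inner_tmul, hS, hT]

/-- With positive square roots, the form at `u` is the squared norm of `(√S ⊗ √T) u`. -/
theorem inner_mapL_self_nonneg [CompleteSpace H] [CompleteSpace K] {S : H →L[ℂ] H}
    {T : K →L[ℂ] K} (hS : S.IsPositive) (hT : T.IsPositive) (u : H ⊗[ℂ] K) :
    0 ≤ inner ℂ u (TensorProduct.mapL S T u) := by
  have hS' := ContinuousLinearMap.nonneg_iff_isPositive S |>.2 hS
  have hT' := ContinuousLinearMap.nonneg_iff_isPositive T |>.2 hT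
  have h1 : ContinuousLinearMap.IsPositive (CFC.sqrt S) :=
    ContinuousLinearMap.nonneg_iff_isPositive _ |>.1 (CFC.sqrt_nonneg S)
  have h2 : ContinuousLinearMap.IsPositive (CFC.sqrt T) :=
    ContinuousLinearMap.nonneg_iff_isPositive _ |>.1 (CFC.sqrt_nonneg T)
  rw [← CFC.sqrt_mul_sqrt_self S hS', ← CFC.sqrt_mul_sqrt_self T hT', TensorProduct.mapL_mul,
    mul_apply_eq_comp, ← inner_mapL_left h1.isSymmetric h2.isSymmetric]
  rw [inner_self_eq_norm_sq_to_K]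
  positivity

end OpTensor

/-! ### The tensor product of two quantum probability measures. -/

section Product

variable {A B : Type*} [MeasurableSpace A] [MeasurableSpace B]
  {H K : Type*} [NormedAddCommGroup H] [InnerProductSpace ℂ H]
  [NormedAddCommGroup K] [InnerProductSpace ℂ K]

namespace QPM

/-- On elementary tensors this is a product of two complex measures; sums handle the rest.
Decompositions into elementary tensors are not unique, but values on rectangles determine the
measure, so (bi)linearity can be recovered afterwards. -/
theorem exists_tensorForm (E : QPM A H) (F : QPM B K) (u v : H ⊗[ℂ] K) :
    ∃ c : ComplexMeasure (A × B), ∀ α β, MeasurableSet α → MeasurableSet β →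
      c (α ×ˢ β) = inner ℂ v (TensorProduct.mapL (E α) (F β) u) := by
  induction u with
  | zero => exact ⟨0, fun _ _ _ _ => by simp⟩
  | add u u' h h' =>
    obtain ⟨c, hc⟩ := h
    obtain ⟨c', hc'⟩ := h'
    exact ⟨c + c', fun α β hα hβ => by
      simp only [_root_.add_apply, hc α β hα hβ, hc' α β hα hβ, map_add, inner_add_right]⟩
  | tmul ξ ξ' =>
    induction v with
    | zero => exact ⟨0, fun _ _ _ _ => by simp⟩
    | add u u' h h' =>
      obtain ⟨c, hc⟩ := h
      obtain ⟨c', hc'⟩ := h'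
      exact ⟨c + c', fun α β hα hβ => by
        simp only [_root_.add_apply, hc α β hα hβ, hc' α β hα hβ, inner_add_left]⟩
    | tmul η η' =>
      refine ⟨(E.complexMeasure ξ η).prod (F.complexMeasure ξ' η')
        (ContinuousLinearMap.mul ℝ ℂ), fun α β hα hβ => ?_⟩
      rw [VectorMeasure.prod_apply, complexMeasure_apply _ _ _ hα, complexMeasure_apply _ _ _ hβ,
        TensorProduct.mapL_tmul, TensorProduct.inner_tmul, ContinuousLinearMap.mul_apply']

/-- The complex measure extending `α × β ↦ ⟨(E(α) ⊗ F(β)) u, v⟩`. -/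
def tensorForm (E : QPM A H) (F : QPM B K) (u v : H ⊗[ℂ] K) : ComplexMeasure (A × B) :=
  (exists_tensorForm E F u v).choose

theorem tensorForm_prod (E : QPM A H) (F : QPM B K) (u v : H ⊗[ℂ] K) {α : Set A} {β : Set B}
    (hα : MeasurableSet α) (hβ : MeasurableSet β) :
    tensorForm E F u v (α ×ˢ β) = inner ℂ v (TensorProduct.mapL (E α) (F β) u) :=
  (exists_tensorForm E F u v).choose_spec α β hα hβ

theorem tensorForm_univ (E : QPM A H) (F : QPM B K) (u v : H ⊗[ℂ] K) :
    tensorForm E F u v univ = inner ℂ v u := by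
  rw [← univ_prod_univ, tensorForm_prod _ _ _ _ .univ .univ, E.univ_eq_one, F.univ_eq_one]
  congr 1
  exact congrArg (· u) (TensorProduct.mapL_id_id (𝕜 := ℂ) (E := H) (G := K))

theorem tensorForm_add (E : QPM A H) (F : QPM B K) (u u' v : H ⊗[ℂ] K) :
    tensorForm E F (u + u') v = tensorForm E F u v + tensorForm E F u' v :=
  complexMeasure_ext_prod fun α β hα hβ => by
    simp only [_root_.add_apply, tensorForm_prod _ _ _ _ hα hβ, map_add, inner_add_right]

theorem tensorForm_smul (E : QPM A H) (F : QPM B K) (a : ℂ) (u v : H ⊗[ℂ] K) :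
    tensorForm E F (a • u) v = a • tensorForm E F u v :=
  complexMeasure_ext_prod fun α β hα hβ => by
    simp only [_root_.smul_apply, tensorForm_prod _ _ _ _ hα hβ, smul_eq_mul]
    rw [ContinuousLinearMap.map_smul]
    exact inner_smul_right _ _ _

theorem conj_tensorForm (E : QPM A H) (F : QPM B K) (u v : H ⊗[ℂ] K) (L : Set (A × B)) :
    conj (tensorForm E F u v L) = tensorForm E F v u L := by
  have h : (tensorForm E F u v).mapRange (starRingEnd ℂ).toAddMonoidHom Complex.continuous_conj
      = tensorForm E F v u := complexMeasure_ext_prod fun α β hα hβ => by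
    rw [VectorMeasure.mapRange_apply, tensorForm_prod _ _ _ _ hα hβ,
      tensorForm_prod _ _ _ _ hα hβ, ← inner_mapL_left (E.isPositive α hα).isSymmetric
        (F.isPositive β hβ).isSymmetric]
    exact inner_conj_symm _ _
  rw [← h]
  rfl

variable [CompleteSpace H] [CompleteSpace K]

theorem tensorForm_nonneg (E : QPM A H) (F : QPM B K) (u : H ⊗[ℂ] K) (L : Set (A × B)) :
    0 ≤ tensorForm E F u u L :=
  nonneg_of_nonneg_prod (fun α β hα hβ => by
    rw [tensorForm_prod _ _ _ _ hα hβ]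
    exact inner_mapL_self_nonneg (E.isPositive α hα) (F.isPositive β hβ) u) L

/-- The complement of `L` also has nonnegative mass, and the total mass is `‖u‖²`. -/
theorem re_tensorForm_le (E : QPM A H) (F : QPM B K) (u : H ⊗[ℂ] K) (L : Set (A × B)) :
    (tensorForm E F u u L).re ≤ ‖u‖ ^ 2 := by
  by_cases hL : MeasurableSet L
  · have h := (Complex.nonneg_iff.1 (tensorForm_nonneg E F u Lᶜ)).1
    rw [VectorMeasure.of_compl hL, tensorForm_univ, Complex.sub_re] at h
    have h2 : (inner ℂ u u).re = ‖u‖ ^ 2 := inner_self_eq_norm_sq (𝕜 := ℂ) u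
    linarith
  · rw [VectorMeasure.not_measurable _ hL]
    simp

theorem exists_tensorOp (E : QPM A H) (F : QPM B K) (L : Set (A × B)) :
    ∃ T : HilbertTensor H K →L[ℂ] HilbertTensor H K, ∀ u v : H ⊗[ℂ] K,
      inner ℂ (v : HilbertTensor H K) (T u) = tensorForm E F u v L :=
  exists_operator_of_form (fun u v => tensorForm E F u v L)
    (fun u u' v => by simp only [tensorForm_add, _root_.add_apply])
    (fun a u v => by simp only [tensorForm_smul, _root_.smul_apply, smul_eq_mul])
    (fun u v => conj_tensorForm E F u v L) (fun u => tensorForm_nonneg E F u L)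
    (fun u => re_tensorForm_le E F u L)

/-- The operator `(E ⊗ F)(L)`. -/
def tensorOp (E : QPM A H) (F : QPM B K) (L : Set (A × B)) :
    HilbertTensor H K →L[ℂ] HilbertTensor H K :=
  (exists_tensorOp E F L).choose

theorem inner_tensorOp (E : QPM A H) (F : QPM B K) (L : Set (A × B)) (u v : H ⊗[ℂ] K) :
    inner ℂ (v : HilbertTensor H K) (tensorOp E F L u) = tensorForm E F u v L :=
  (exists_tensorOp E F L).choose_spec u v

/-- The tensor product of two quantum probability measures. -/
def prod (E : QPM A H) (F : QPM B K) : QPM (A × B) (HilbertTensor H K) where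
  toFun := tensorOp E F
  isPositive L _ := isPositive_completion fun u => by
    rw [inner_tensorOp]
    exact tensorForm_nonneg E F u L
  univ_eq_one := ext_inner_completion fun u v => by
    rw [inner_tensorOp, tensorForm_univ, one_apply_eq_self, Completion.inner_coe]
  iUnion L hL hd := by
    have hpos : ∀ i, (tensorOp E F (L i)).IsPositive := fun i => isPositive_completion fun u => by
      rw [inner_tensorOp]
      exact tensorForm_nonneg E F u _
    refine hasWeakStarSum_of_hasSum_inner hpos (hasSum_inner_completion hpos fun u => ?_)
    simp only [inner_tensorOp]
    exact (tensorForm E F u u).m_iUnion hL hd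

theorem prod_prod (E : QPM A H) (F : QPM B K) {α : Set A} {β : Set B}
    (hα : MeasurableSet α) (hβ : MeasurableSet β) :
    E.prod F (α ×ˢ β) = opTensor (E α) (F β) :=
  ext_inner_completion fun u v => by
    rw [opTensor_coe, Completion.inner_coe]
    exact (inner_tensorOp E F _ u v).trans (tensorForm_prod E F u v hα hβ)

end QPM

end Product

end MeasurableNS

namespace MeasurableNS

open UniformSpace

/-! ### Weak measurability and tensor products of channels. -/

section Channel

variable {X Y A B : Type*} [MeasurableSpace X] [MeasurableSpace Y]
  [MeasurableSpace A] [MeasurableSpace B]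

/-- Pointwise limits of measurable functions are measurable, so the good pairs of vectors form a
sequentially closed set containing a dense one. -/
theorem measurable_inner_completion {D : Type*} [NormedAddCommGroup D] [InnerProductSpace ℂ D]
    {T : X → Completion D →L[ℂ] Completion D}
    (h : ∀ u v : D, Measurable fun x => inner ℂ (v : Completion D) (T x u))
    (ξ η : Completion D) : Measurable fun x => inner ℂ η (T x ξ) := by
  refine Completion.induction_on₂ ξ η (IsSeqClosed.isClosed ?_) h
  intro p q hp hpq
  refine measurable_of_tendsto_metrizable hp (tendsto_pi_nhds.2 fun x => ?_)
  exact ((continuous_snd.inner ((T x).continuous.comp continuous_fst)).tendsto q).comp hpq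

variable {H K : Type*} [NormedAddCommGroup H] [InnerProductSpace ℂ H]
  [NormedAddCommGroup K] [InnerProductSpace ℂ K]

theorem measurable_inner_opTensor {S : X → H →L[ℂ] H} {T : Y → K →L[ℂ] K}
    (hS : ∀ ξ η, Measurable fun x => inner ℂ η (S x ξ))
    (hT : ∀ ξ η, Measurable fun y => inner ℂ η (T y ξ)) (ξ η : HilbertTensor H K) :
    Measurable fun z : X × Y => inner ℂ η (opTensor (S z.1) (T z.2) ξ) := by
  refine measurable_inner_completion (T := fun z : X × Y => opTensor (S z.1) (T z.2))
    (fun u v => ?_) ξ η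
  simp only [opTensor_coe, Completion.inner_coe]
  induction u with
  | zero => simp
  | add u u' h h' => simpa only [map_add, inner_add_right] using h.fun_add h'
  | tmul x y =>
    induction v with
    | zero => simp
    | add v v' h h' => simpa only [inner_add_left] using h.fun_add h'
    | tmul x' y' =>
      simp only [TensorProduct.mapL_tmul, TensorProduct.inner_tmul]
      exact ((hS x x').comp measurable_fst).mul ((hT y y').comp measurable_snd)

/-- Weak measurability of a family of quantum probability measures on a product can be tested on
measurable rectangles. -/
theorem measurable_inner_of_prod {E : X → QPM (A × B) H}
    (h : ∀ α β, MeasurableSet α → MeasurableSet β → ∀ ξ η : H,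
      Measurable fun x => inner ℂ η (E x (α ×ˢ β) ξ))
    {L : Set (A × B)} (hL : MeasurableSet L) (ξ η : H) :
    Measurable fun x => inner ℂ η (E x L ξ) := by
  induction L, hL using MeasurableSpace.induction_on_inter generateFrom_prod.symm
    isPiSystem_prod with
  | empty => simp [QPM.inner_empty]
  | basic t ht =>
    obtain ⟨α, hα, β, hβ, rfl⟩ := ht
    exact h α β hα hβ ξ η
  | compl t ht ih =>
    simp only [fun x => (E x).apply_compl ht, _root_.sub_apply, inner_sub_right]
    exact measurable_const.sub ih
  | iUnion f hd hf ih =>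
    refine measurable_of_tendsto_metrizable
      (f := fun n x => ∑ i ∈ Finset.range n, inner ℂ η (E x (f i) ξ))
      (fun n => Finset.measurable_fun_sum _ fun i _ => ih i) (tendsto_pi_nhds.2 fun x => ?_)
    exact ((E x).hasSum_inner ξ η hf hd).tendsto_sum_nat

namespace OpChannel

variable [CompleteSpace H] [CompleteSpace K]

/-- The tensor product of two operator-valued channels. -/
def prod (E : OpChannel X A H) (F : OpChannel Y B K) :
    OpChannel (X × Y) (A × B) (HilbertTensor H K) where
  toFun z := (E z.1).prod (F z.2)
  weaklyMeasurable L hL ξ η := by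
    refine measurable_inner_of_prod (E := fun z : X × Y => (E z.1).prod (F z.2))
      (fun α β hα hβ ξ η => ?_) hL ξ η
    simp only [QPM.prod_prod _ _ hα hβ]
    exact measurable_inner_opTensor (fun ξ η => E.weaklyMeasurable α hα ξ η)
      (fun ξ η => F.weaklyMeasurable β hβ ξ η) ξ η

theorem prod_apply (E : OpChannel X A H) (F : OpChannel Y B K) (x : X) (y : Y) :
    E.prod F (x, y) = (E x).prod (F y) := rfl

end OpChannel

end Channel

/-! ### Interchanging the middle coordinates of product measures. -/

section Shuffle

variable {A B A' B' : Type*}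

/-- The interchange of the two middle coordinates. -/
def middleSwap (z : (A × B) × (A' × B')) : (A × A') × (B × B') :=
  ((z.1.1, z.2.1), (z.1.2, z.2.2))

theorem middleSwap_preimage_dotProd (L : Set (A × B)) (L' : Set (A' × B')) :
    middleSwap ⁻¹' dotProd L L' = L ×ˢ L' := rfl

theorem middleSwap_preimage_prod (α : Set A) (α' : Set A') (β : Set B) (β' : Set B') :
    middleSwap ⁻¹' ((α ×ˢ α') ×ˢ (β ×ˢ β')) = (α ×ˢ β) ×ˢ (α' ×ˢ β') := by
  ext ⟨⟨a, b⟩, ⟨a', b'⟩⟩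
  simp only [middleSwap, mem_preimage, mem_prod]
  tauto

variable [MeasurableSpace A] [MeasurableSpace B] [MeasurableSpace A'] [MeasurableSpace B']

theorem measurable_middleSwap : Measurable (middleSwap (A := A) (B := B) (A' := A') (B' := B')) := by
  unfold middleSwap
  fun_prop

/-- Pulled back by the swap, the hypothesis characterises a product measure on rectangles; the swap
is its own inverse. -/
theorem eq_map_middleSwap_of_dotProd {μ : Measure (A × B)} {ν : Measure (A' × B')}
    [IsFiniteMeasure μ] [IsFiniteMeasure ν] {ρ : Measure ((A × A') × (B × B'))}
    (h : ∀ L L', MeasurableSet L → MeasurableSet L' → ρ (dotProd L L') = μ L * ν L') :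
    ρ = (μ.prod ν).map middleSwap := by
  have h1 : μ.prod ν = ρ.map middleSwap := Measure.prod_eq fun L L' hL hL' => by
    rw [Measure.map_apply measurable_middleSwap (hL.prod hL'), ← h L L' hL hL']
    rfl
  rw [h1, Measure.map_map measurable_middleSwap measurable_middleSwap]
  exact Measure.map_id.symm

/-- The whole product as an exhaustion by measurable rectangles. -/
def rectangleSpanningSets (μ : Measure (A × B)) [IsFiniteMeasure μ] : μ.FiniteSpanningSetsIn
    (image2 (· ×ˢ ·) {s : Set A | MeasurableSet s} {t : Set B | MeasurableSet t}) where
  set _ := univ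
  set_mem _ := ⟨univ, .univ, univ, .univ, univ_prod_univ⟩
  finite _ := measure_lt_top _ _
  spanning := iUnion_const _

theorem map_middleSwap_prod_prod (q : Measure A) (r : Measure B) (q' : Measure A')
    (r' : Measure B') [IsFiniteMeasure q] [IsFiniteMeasure r] [IsFiniteMeasure q']
    [IsFiniteMeasure r'] :
    ((q.prod r).prod (q'.prod r')).map middleSwap = (q.prod q').prod (r.prod r') := by
  refine (Measure.prod_eq_generateFrom generateFrom_prod generateFrom_prod isPiSystem_prod
    isPiSystem_prod (rectangleSpanningSets _) (rectangleSpanningSets _) ?_).symm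
  rintro _ ⟨α, hα, α', hα', rfl⟩ _ ⟨β, hβ, β', hβ', rfl⟩
  rw [Measure.map_apply measurable_middleSwap ((hα.prod hα').prod (hβ.prod hβ')),
    middleSwap_preimage_prod]
  simp only [Measure.prod_prod]
  ring

end Shuffle

/-! ### Existence and uniqueness of the product correlation; the local case. -/

section Correlation

variable {X₁ Y₁ A₁ B₁ X₂ Y₂ A₂ B₂ : Type*}
  [MeasurableSpace X₁] [MeasurableSpace Y₁] [MeasurableSpace A₁] [MeasurableSpace B₁]
  [MeasurableSpace X₂] [MeasurableSpace Y₂] [MeasurableSpace A₂] [MeasurableSpace B₂]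
  {p₁ : NSCorrelation X₁ Y₁ A₁ B₁} {p₂ : NSCorrelation X₂ Y₂ A₂ B₂}
  {p : NSCorrelation (X₁ × X₂) (Y₁ × Y₂) (A₁ × A₂) (B₁ × B₂)}

attribute [instance] NSCorrelation.isMarkov

theorem IsCorrelationProduct.kernel_apply (h : IsCorrelationProduct p₁ p₂ p) (x₁ : X₁) (x₂ : X₂)
    (y₁ : Y₁) (y₂ : Y₂) : p.kernel ((x₁, x₂), (y₁, y₂)) =
      ((p₁.kernel (x₁, y₁)).prod (p₂.kernel (x₂, y₂))).map middleSwap :=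
  eq_map_middleSwap_of_dotProd (h x₁ x₂ y₁ y₂)

variable (p₁ p₂) in
/-- The Markov kernel of the tensor product of two correlations. -/
def tensorKernel : Kernel ((X₁ × X₂) × (Y₁ × Y₂)) ((A₁ × A₂) × (B₁ × B₂)) :=
  ((p₁.kernel ∥ₖ p₂.kernel).comap middleSwap measurable_middleSwap).map middleSwap

theorem tensorKernel_apply (x₁ : X₁) (x₂ : X₂) (y₁ : Y₁) (y₂ : Y₂) :
    tensorKernel p₁ p₂ ((x₁, x₂), (y₁, y₂)) =
      ((p₁.kernel (x₁, y₁)).prod (p₂.kernel (x₂, y₂))).map middleSwap := by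
  rw [tensorKernel, Kernel.map_apply _ measurable_middleSwap, Kernel.comap_apply,
    Kernel.parallelComp_apply]
  rfl

theorem tensorKernel_apply_prod_univ (x₁ : X₁) (x₂ : X₂) (y₁ : Y₁) (y₂ : Y₂)
    {α : Set (A₁ × A₂)} (hα : MeasurableSet α) :
    tensorKernel p₁ p₂ ((x₁, x₂), (y₁, y₂)) (α ×ˢ univ) =
      ((p₁.kernel (x₁, y₁)).map Prod.fst).prod ((p₂.kernel (x₂, y₂)).map Prod.fst) α := by
  rw [tensorKernel_apply, Measure.map_apply measurable_middleSwap (hα.prod .univ),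
    Measure.map_prod_map _ _ measurable_fst measurable_fst,
    Measure.map_apply (measurable_fst.prodMap measurable_fst) hα]
  congr 1
  ext z
  simp [middleSwap, Prod.map]

theorem tensorKernel_apply_univ_prod (x₁ : X₁) (x₂ : X₂) (y₁ : Y₁) (y₂ : Y₂)
    {β : Set (B₁ × B₂)} (hβ : MeasurableSet β) :
    tensorKernel p₁ p₂ ((x₁, x₂), (y₁, y₂)) (univ ×ˢ β) =
      ((p₁.kernel (x₁, y₁)).map Prod.snd).prod ((p₂.kernel (x₂, y₂)).map Prod.snd) β := by
  rw [tensorKernel_apply, Measure.map_apply measurable_middleSwap (MeasurableSet.univ.prod hβ),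
    Measure.map_prod_map _ _ measurable_snd measurable_snd,
    Measure.map_apply (measurable_snd.prodMap measurable_snd) hβ]
  congr 1
  ext z
  simp [middleSwap, Prod.map]

namespace NSCorrelation

variable {X Y A B : Type*} [MeasurableSpace X] [MeasurableSpace Y]
  [MeasurableSpace A] [MeasurableSpace B]

theorem map_fst_eq (p : NSCorrelation X Y A B) (x : X) (y y' : Y) :
    (p.kernel (x, y)).map Prod.fst = (p.kernel (x, y')).map Prod.fst := by
  ext α hα
  rw [Measure.map_apply measurable_fst hα, Measure.map_apply measurable_fst hα, ← prod_univ]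
  exact p.left_marginal x y y' α hα

theorem map_snd_eq (p : NSCorrelation X Y A B) (x x' : X) (y : Y) :
    (p.kernel (x, y)).map Prod.snd = (p.kernel (x', y)).map Prod.snd := by
  ext β hβ
  rw [Measure.map_apply measurable_snd hβ, Measure.map_apply measurable_snd hβ, ← univ_prod]
  exact p.right_marginal x x' y β hβ

variable (p₁ p₂) in
/-- The tensor product of two measurable no-signalling correlations. -/
def tensor : NSCorrelation (X₁ × X₂) (Y₁ × Y₂) (A₁ × A₂) (B₁ × B₂) where
  kernel := tensorKernel p₁ p₂
  isMarkov := by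
    unfold tensorKernel
    exact Kernel.IsMarkovKernel.map _ measurable_middleSwap
  left_marginal := by
    rintro ⟨x₁, x₂⟩ ⟨y₁, y₂⟩ ⟨y₁', y₂'⟩ α hα
    rw [tensorKernel_apply_prod_univ _ _ _ _ hα, tensorKernel_apply_prod_univ _ _ _ _ hα,
      p₁.map_fst_eq x₁ y₁ y₁', p₂.map_fst_eq x₂ y₂ y₂']
  right_marginal := by
    rintro ⟨x₁, x₂⟩ ⟨x₁', x₂'⟩ ⟨y₁, y₂⟩ β hβ
    rw [tensorKernel_apply_univ_prod _ _ _ _ hβ, tensorKernel_apply_univ_prod _ _ _ _ hβ,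
      p₁.map_snd_eq x₁ x₁' y₁, p₂.map_snd_eq x₂ x₂' y₂]

end NSCorrelation

theorem measurableSet_dotProd {A B A' B' : Type*} [MeasurableSpace A] [MeasurableSpace B]
    [MeasurableSpace A'] [MeasurableSpace B'] {L : Set (A × B)} {L' : Set (A' × B')}
    (hL : MeasurableSet L) (hL' : MeasurableSet L') : MeasurableSet (dotProd L L') :=
  measurable_middleSwap (hL.prod hL')

theorem isCorrelationProduct_tensor :
    IsCorrelationProduct p₁ p₂ (NSCorrelation.tensor p₁ p₂) := by
  intro x₁ x₂ y₁ y₂ L L' hL hL'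
  refine (congrArg (· (dotProd L L')) (tensorKernel_apply x₁ x₂ y₁ y₂)).trans ?_
  rw [Measure.map_apply measurable_middleSwap (measurableSet_dotProd hL hL'),
    middleSwap_preimage_dotProd, Measure.prod_prod]

theorem IsCorrelationProduct.unique
    {p' : NSCorrelation (X₁ × X₂) (Y₁ × Y₂) (A₁ × A₂) (B₁ × B₂)}
    (h : IsCorrelationProduct p₁ p₂ p) (h' : IsCorrelationProduct p₁ p₂ p') : p = p' := by
  refine NSCorrelation.ext (Kernel.ext ?_)
  rintro ⟨⟨x₁, x₂⟩, ⟨y₁, y₂⟩⟩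
  rw [h.kernel_apply, h'.kernel_apply]

theorem IsCorrelationProduct.isLocal (h : IsCorrelationProduct p₁ p₂ p)
    (h₁ : p₁.IsLocal) (h₂ : p₂.IsLocal) : p.IsLocal := by
  obtain ⟨n, lam, q, r, hq, hr, hlam, hp₁⟩ := h₁
  obtain ⟨m, lam', q', r', hq', hr', hlam', hp₂⟩ := h₂
  let e : Fin n × Fin m ≃ Fin (n * m) := finProdFinEquiv
  refine ⟨n * m, fun k => lam (e.symm k).1 * lam' (e.symm k).2,
    fun k => q (e.symm k).1 ∥ₖ q' (e.symm k).2, fun k => r (e.symm k).1 ∥ₖ r' (e.symm k).2,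
    fun k => inferInstance, fun k => inferInstance, ?_, ?_⟩
  · rw [← e.sum_comp]
    simp only [Equiv.symm_apply_apply]
    rw [Fintype.sum_prod_type, ← Finset.sum_mul_sum, hlam, hlam', one_mul]
  · rintro ⟨x₁, x₂⟩ ⟨y₁, y₂⟩
    rw [h.kernel_apply]
    -- It suffices to test the convex combination on `dotProd` sets, where it becomes the expansion
    -- of a product of two finite sums.
    refine (eq_map_middleSwap_of_dotProd fun L L' hL hL' => ?_).symm
    rw [← e.sum_comp, hp₁, hp₂]
    have hK : ∀ i j, ((q i ∥ₖ q' j) (x₁, x₂)).prod ((r i ∥ₖ r' j) (y₁, y₂)) =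
        (((q i x₁).prod (r i y₁)).prod ((q' j x₂).prod (r' j y₂))).map middleSwap := fun i j => by
      rw [map_middleSwap_prod_prod, Kernel.parallelComp_apply, Kernel.parallelComp_apply]
    simp only [Equiv.symm_apply_apply, hK, Measure.finsetSum_apply, Measure.smul_apply,
      Measure.map_apply measurable_middleSwap (measurableSet_dotProd hL hL'),
      middleSwap_preimage_dotProd, Measure.prod_prod]
    rw [Fintype.sum_prod_type, Finset.sum_mul_sum]
    refine Finset.sum_congr rfl fun i _ => Finset.sum_congr rfl fun j _ => ?_
    simp only [ENNReal.smul_def, ENNReal.coe_mul, smul_eq_mul]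
    ring

end Correlation

end MeasurableNS

namespace MeasurableNS

open UniformSpace

/-! ### Factorisation of operator measures from rectangles of rectangles. -/

section Extensionality

variable {A B A' B' : Type*} [MeasurableSpace A] [MeasurableSpace B]
  [MeasurableSpace A'] [MeasurableSpace B']

/-- Two complex measures on a product of products which agree on the products of measurable
rectangles are equal. -/
theorem complexMeasure_ext_prod_prod {c d : ComplexMeasure ((A × B) × (A' × B'))}
    (h : ∀ α β α' β', MeasurableSet α → MeasurableSet β → MeasurableSet α' → MeasurableSet β' →
      c ((α ×ˢ β) ×ˢ (α' ×ˢ β')) = d ((α ×ˢ β) ×ˢ (α' ×ˢ β'))) : c = d := by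
  refine VectorMeasure.ext_of_generateFrom _ ?_ (generateFrom_eq_prod generateFrom_prod
    generateFrom_prod (isCountablySpanning_measurableSet.prod isCountablySpanning_measurableSet)
    (isCountablySpanning_measurableSet.prod isCountablySpanning_measurableSet)).symm
    (isPiSystem_prod.prod isPiSystem_prod) ?_
  · rintro _ ⟨_, ⟨α, hα, β, hβ, rfl⟩, _, ⟨α', hα', β', hβ', rfl⟩, rfl⟩
    exact h α β α' β' hα hβ hα' hβ'
  · simp only [← univ_prod_univ]
    exact h _ _ _ _ .univ .univ .univ .univ

variable {H : Type*} [NormedAddCommGroup H] [InnerProductSpace ℂ H]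

namespace QPM

/-- A quantum probability measure on a product of products which factorises on the products of
measurable rectangles factorises on all measurable rectangles. -/
theorem apply_prod_eq_mul {G : QPM ((A × A') × (B × B')) H} {E : QPM (A × A') H}
    {F : QPM (B × B') H}
    (h : ∀ α α' β β', MeasurableSet α → MeasurableSet α' → MeasurableSet β → MeasurableSet β' →
      G ((α ×ˢ α') ×ˢ (β ×ˢ β')) = E (α ×ˢ α') * F (β ×ˢ β'))
    {s : Set (A × A')} {t : Set (B × B')} (hs : MeasurableSet s) (ht : MeasurableSet t) :
    G (s ×ˢ t) = E s * F t := by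
  -- One variable at a time: with `β ×ˢ β'` fixed, both sides are complex measures in `s`. The
  -- second pass fixes `s` and varies `t`.
  have h1 : ∀ ξ η s β β', MeasurableSet s → MeasurableSet β → MeasurableSet β' →
      inner ℂ η (G (s ×ˢ (β ×ˢ β')) ξ) = inner ℂ η (E s (F (β ×ˢ β') ξ)) := by
    intro ξ η s β β' hs hβ hβ'
    have hu : MeasurableSet ((univ : Set (A × A')) ×ˢ (β ×ˢ β')) :=
      MeasurableSet.univ.prod (hβ.prod hβ')
    have hm : ∀ s : Set (A × A'), MeasurableSet s →
        ((G.complexMeasure ξ η).restrict (univ ×ˢ (β ×ˢ β'))).map Prod.fst s =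
          inner ℂ η (G (s ×ˢ (β ×ˢ β')) ξ) := fun s hs => by
      rw [VectorMeasure.map_apply _ measurable_fst hs,
        VectorMeasure.restrict_apply _ hu (measurable_fst hs), ← prod_univ, prod_inter_prod,
        inter_univ, univ_inter, complexMeasure_apply _ _ _ (hs.prod (hβ.prod hβ'))]
    have he : ((G.complexMeasure ξ η).restrict (univ ×ˢ (β ×ˢ β'))).map Prod.fst =
        E.complexMeasure (F (β ×ˢ β') ξ) η := complexMeasure_ext_prod fun α α' hα hα' => by
      rw [hm _ (hα.prod hα'), complexMeasure_apply _ _ _ (hα.prod hα'), h α α' β β' hα hα' hβ hβ',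
        mul_apply_eq_comp]
    rw [← hm s hs, he, complexMeasure_apply _ _ _ hs]
  refine ContinuousLinearMap.ext fun ξ => ext_inner_left ℂ fun η => ?_
  have hu : MeasurableSet (s ×ˢ (univ : Set (B × B'))) := hs.prod .univ
  have hm : ∀ t : Set (B × B'), MeasurableSet t →
      ((G.complexMeasure ξ η).restrict (s ×ˢ univ)).map Prod.snd t =
        inner ℂ η (G (s ×ˢ t) ξ) := fun t ht => by
    rw [VectorMeasure.map_apply _ measurable_snd ht,
      VectorMeasure.restrict_apply _ hu (measurable_snd ht), ← univ_prod, prod_inter_prod,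
      inter_univ, univ_inter, complexMeasure_apply _ _ _ (hs.prod ht)]
  -- `E s` is symmetric, so it moves onto `η` and leaves a scalar measure of `F` alone.
  have he : ((G.complexMeasure ξ η).restrict (s ×ˢ univ)).map Prod.snd =
      F.complexMeasure ξ (E s η) := complexMeasure_ext_prod fun β β' hβ hβ' => by
    rw [hm _ (hβ.prod hβ'), complexMeasure_apply _ _ _ (hβ.prod hβ'), h1 ξ η s β β' hs hβ hβ']
    exact ((E.isPositive s hs).isSymmetric _ _).symm
  rw [← hm t ht, he, complexMeasure_apply _ _ _ ht]
  exact (E.isPositive s hs).isSymmetric _ _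

end QPM

/-- `S T` is symmetric, hence equal to its formal adjoint `T S`. -/
theorem commute_of_isPositive_mul {S T : H →L[ℂ] H} (hS : S.IsPositive) (hT : T.IsPositive)
    (h : (S * T).IsPositive) : Commute S T := by
  refine ContinuousLinearMap.ext fun ξ => ext_inner_left ℂ fun η => ?_
  refine (h.isSymmetric η ξ).symm.trans ?_
  exact (hS.isSymmetric _ _).trans (hT.isSymmetric _ _)

end Extensionality

/-! ### Vector states at elementary tensors. -/

section VectorState

variable {A B : Type*} [MeasurableSpace A] [MeasurableSpace B]
  {H K : Type*} [NormedAddCommGroup H] [InnerProductSpace ℂ H] [CompleteSpace H]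
  [NormedAddCommGroup K] [InnerProductSpace ℂ K] [CompleteSpace K]

/-- The product of the measures defined by two vectors is the measure defined by their tensor
product. -/
theorem real_prod_eq_inner_tmul {E : QPM A H} {F : QPM B K} {ξ : H} {η : K}
    {μ : Measure A} {ν : Measure B} [IsFiniteMeasure μ] [IsFiniteMeasure ν]
    (hμ : ∀ α, MeasurableSet α → (μ.real α : ℂ) = inner ℂ ξ (E α ξ))
    (hν : ∀ β, MeasurableSet β → (ν.real β : ℂ) = inner ℂ η (F β η))
    {L : Set (A × B)} (hL : MeasurableSet L) :
    ((μ.prod ν).real L : ℂ) = inner ℂ ((ξ ⊗ₜ[ℂ] η : H ⊗[ℂ] K) : HilbertTensor H K)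
      (E.prod F L ((ξ ⊗ₜ[ℂ] η : H ⊗[ℂ] K) : HilbertTensor H K)) := by
  have hm : ∀ L : Set (A × B), MeasurableSet L →
      (μ.prod ν).toSignedMeasure.toComplexMeasure 0 L = ((μ.prod ν).real L : ℂ) := fun L hL => by
    rw [SignedMeasure.toComplexMeasure_apply, Measure.toSignedMeasure_apply_measurable hL]
    rfl
  have he : (μ.prod ν).toSignedMeasure.toComplexMeasure 0 =
      (E.prod F).complexMeasure ((ξ ⊗ₜ[ℂ] η : H ⊗[ℂ] K) : HilbertTensor H K)
        ((ξ ⊗ₜ[ℂ] η : H ⊗[ℂ] K) : HilbertTensor H K) :=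
    complexMeasure_ext_prod fun α β hα hβ => by
      rw [hm _ (hα.prod hβ), QPM.complexMeasure_apply _ _ _ (hα.prod hβ), QPM.prod_prod _ _ hα hβ,
        opTensor_coe, Completion.inner_coe, TensorProduct.mapL_tmul, TensorProduct.inner_tmul,
        ← hμ α hα, ← hν β hβ, measureReal_prod_prod, Complex.ofReal_mul]
  rw [← hm L hL, he, QPM.complexMeasure_apply _ _ _ hL]

theorem norm_coe_tmul {H K : Type*} [NormedAddCommGroup H] [InnerProductSpace ℂ H]
    [NormedAddCommGroup K] [InnerProductSpace ℂ K] {ξ : H} {η : K} (hξ : ‖ξ‖ = 1) (hη : ‖η‖ = 1) :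
    ‖((ξ ⊗ₜ[ℂ] η : H ⊗[ℂ] K) : HilbertTensor H K)‖ = 1 := by
  rw [Completion.norm_coe, TensorProduct.norm_tmul, hξ, hη, one_mul]

end VectorState

/-! ### The interchange isometry of fourfold Hilbert tensor products. -/

section Interchange

variable {H K H' K' : Type*}
  [NormedAddCommGroup H] [InnerProductSpace ℂ H] [NormedAddCommGroup K] [InnerProductSpace ℂ K]
  [NormedAddCommGroup H'] [InnerProductSpace ℂ H']
  [NormedAddCommGroup K'] [InnerProductSpace ℂ K']

theorem tmul_tmul_induction {P : (H ⊗[ℂ] K) ⊗[ℂ] (H' ⊗[ℂ] K') → Prop} (zero : P 0)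
    (add : ∀ u v, P u → P v → P (u + v))
    (tmul : ∀ a b c d, P ((a ⊗ₜ b) ⊗ₜ (c ⊗ₜ d))) (w) : P w := by
  induction w with
  | zero => exact zero
  | add u v hu hv => exact add u v hu hv
  | tmul u v =>
    induction u with
    | zero => rwa [TensorProduct.zero_tmul]
    | add u u' hu hu' =>
      rw [TensorProduct.add_tmul]
      exact add _ _ hu hu'
    | tmul a b =>
      induction v with
      | zero => rwa [TensorProduct.tmul_zero]
      | add v v' hv hv' =>
        rw [TensorProduct.tmul_add]
        exact add _ _ hv hv'
      | tmul c d => exact tmul a b c d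

variable (H K H' K') in
/-- The embedding of an algebraic tensor product of tensor products into the Hilbert space tensor
product. -/
def toHilbertTensor : (H ⊗[ℂ] K) ⊗[ℂ] (H' ⊗[ℂ] K') →ₗ[ℂ]
    HilbertTensor (HilbertTensor H K) (HilbertTensor H' K') :=
  (Completion.toComplₗᵢ.comp
    (TensorProduct.mapIsometry Completion.toComplₗᵢ Completion.toComplₗᵢ)).toLinearMap

theorem toHilbertTensor_tmul (u : H ⊗[ℂ] K) (v : H' ⊗[ℂ] K') :
    toHilbertTensor H K H' K' (u ⊗ₜ v) =
      (((u : HilbertTensor H K) ⊗ₜ[ℂ] (v : HilbertTensor H' K') :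
        HilbertTensor H K ⊗[ℂ] HilbertTensor H' K') :
        HilbertTensor (HilbertTensor H K) (HilbertTensor H' K')) := rfl

/-- The tensor map is jointly continuous, so elementary tensors of completed vectors are limits of
algebraic ones. -/
theorem denseRange_toHilbertTensor : DenseRange (toHilbertTensor H K H' K') := by
  let m := (TensorProduct.mapIsometry (Completion.toComplₗᵢ (𝕜 := ℂ) (E := H ⊗[ℂ] K))
    (Completion.toComplₗᵢ (𝕜 := ℂ) (E := H' ⊗[ℂ] K'))).toLinearMap
  have hm : DenseRange m := by
    intro t
    change t ∈ (LinearMap.range m).topologicalClosure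
    induction t with
    | zero => exact zero_mem _
    | add x y hx hy => exact add_mem hx hy
    | tmul ξ η =>
      refine Completion.induction_on₂ ξ η ?_ fun u v => ?_
      · exact (Submodule.isClosed_topologicalClosure (LinearMap.range m)).preimage
          TensorProduct.continuous_tmul
      · exact Submodule.le_topologicalClosure _ ⟨u ⊗ₜ v, rfl⟩
  exact Completion.denseRange_coe.comp hm (Completion.continuous_coe _)

variable (H K H' K') in
/-- The interchange of the two middle factors, before completion of its domain. -/
def interchangeAux : (H ⊗[ℂ] K) ⊗[ℂ] (H' ⊗[ℂ] K') →ₗ[ℂ]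
    HilbertTensor (HilbertTensor H H') (HilbertTensor K K') :=
  toHilbertTensor H H' K K' ∘ₗ (TensorProduct.tensorTensorTensorComm ℂ H K H' K').toLinearMap

theorem interchangeAux_tmul (a : H) (b : K) (c : H') (d : K') :
    interchangeAux H K H' K' ((a ⊗ₜ b) ⊗ₜ (c ⊗ₜ d)) =
      toHilbertTensor H H' K K' ((a ⊗ₜ c) ⊗ₜ (b ⊗ₜ d)) := rfl

theorem inner_coe_tmul (x x' : H) (y y' : K) :
    inner ℂ ((x ⊗ₜ[ℂ] y : H ⊗[ℂ] K) : HilbertTensor H K) ((x' ⊗ₜ[ℂ] y' : H ⊗[ℂ] K) :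
      HilbertTensor H K) = inner ℂ x x' * inner ℂ y y' := by
  rw [Completion.inner_coe, TensorProduct.inner_tmul]

/-- On elementary tensors both sides are the same product of four inner products. The case of
identity operators says that the interchange is isometric, which is what allows its extension. -/
theorem inner_interchangeAux (S : H →L[ℂ] H) (T : K →L[ℂ] K) (S' : H' →L[ℂ] H')
    (T' : K' →L[ℂ] K') (w z : (H ⊗[ℂ] K) ⊗[ℂ] (H' ⊗[ℂ] K')) :
    inner ℂ (interchangeAux H K H' K' w)
      (opTensor (opTensor S S') (opTensor T T') (interchangeAux H K H' K' z)) =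
    inner ℂ (toHilbertTensor H K H' K' w)
      (opTensor (opTensor S T) (opTensor S' T') (toHilbertTensor H K H' K' z)) := by
  induction w using tmul_tmul_induction with
  | zero => simp
  | add u v hu hv => simp only [map_add, inner_add_left, hu, hv]
  | tmul a b c d =>
    induction z using tmul_tmul_induction with
    | zero => simp
    | add u v hu hv => simp only [map_add, inner_add_right, hu, hv]
    | tmul a' b' c' d' =>
      simp only [interchangeAux_tmul, toHilbertTensor_tmul, opTensor_coe, TensorProduct.mapL_tmul]
      refine (inner_coe_tmul _ _ _ _).trans ((inner_coe_tmul _ _ _ _).trans ?_).symm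
      simp only [inner_coe_tmul]
      ring

theorem norm_interchangeAux (w : (H ⊗[ℂ] K) ⊗[ℂ] (H' ⊗[ℂ] K')) :
    ‖interchangeAux H K H' K' w‖ = ‖toHilbertTensor H K H' K' w‖ := by
  have h := inner_interchangeAux (1 : H →L[ℂ] H) (1 : K →L[ℂ] K) (1 : H' →L[ℂ] H')
    (1 : K' →L[ℂ] K') w w
  simp only [opTensor_one, one_apply_eq_self] at h
  rw [norm_eq_sqrt_re_inner (𝕜 := ℂ), norm_eq_sqrt_re_inner (𝕜 := ℂ), h]

variable (H K H' K') in
/-- The interchange of the two middle factors of Hilbert space tensor products. -/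
def interchange : HilbertTensor (HilbertTensor H K) (HilbertTensor H' K') →L[ℂ]
    HilbertTensor (HilbertTensor H H') (HilbertTensor K K') :=
  (interchangeAux H K H' K').extendOfNorm (toHilbertTensor H K H' K')

theorem interchange_toHilbertTensor (w : (H ⊗[ℂ] K) ⊗[ℂ] (H' ⊗[ℂ] K')) :
    interchange H K H' K' (toHilbertTensor H K H' K' w) = interchangeAux H K H' K' w :=
  LinearMap.extendOfNorm_eq denseRange_toHilbertTensor
    ⟨1, fun w => by rw [norm_interchangeAux, one_mul]⟩ w

theorem inner_interchange (S : H →L[ℂ] H) (T : K →L[ℂ] K) (S' : H' →L[ℂ] H')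
    (T' : K' →L[ℂ] K') (ξ η : HilbertTensor (HilbertTensor H K) (HilbertTensor H' K')) :
    inner ℂ (interchange H K H' K' η)
      (opTensor (opTensor S S') (opTensor T T') (interchange H K H' K' ξ)) =
    inner ℂ η (opTensor (opTensor S T) (opTensor S' T') ξ) := by
  refine denseRange_toHilbertTensor.induction_on₂ (p := fun ξ η =>
    inner ℂ (interchange H K H' K' η)
      (opTensor (opTensor S S') (opTensor T T') (interchange H K H' K' ξ)) =
    inner ℂ η (opTensor (opTensor S T) (opTensor S' T') ξ)) ?_ (fun w z => ?_) ξ η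
  · exact isClosed_eq
      (((interchange H K H' K').continuous.comp continuous_snd).inner
        (((opTensor (opTensor S S') (opTensor T T')).continuous.comp
          (interchange H K H' K').continuous).comp continuous_fst))
      (continuous_snd.inner
        ((opTensor (opTensor S T) (opTensor S' T')).continuous.comp continuous_fst))
  · rw [interchange_toHilbertTensor, interchange_toHilbertTensor]
    exact inner_interchangeAux S T S' T' z w

theorem norm_interchange (ξ : HilbertTensor (HilbertTensor H K) (HilbertTensor H' K')) :
    ‖interchange H K H' K' ξ‖ = ‖ξ‖ := by
  have h := inner_interchange (1 : H →L[ℂ] H) (1 : K →L[ℂ] K) (1 : H' →L[ℂ] H')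
    (1 : K' →L[ℂ] K') ξ ξ
  simp only [opTensor_one, one_apply_eq_self] at h
  rw [norm_eq_sqrt_re_inner (𝕜 := ℂ), norm_eq_sqrt_re_inner (𝕜 := ℂ), h]

end Interchange

/-! ### The quantum commuting and quantum spatial cases. -/

section Correlation

variable {X₁ Y₁ A₁ B₁ X₂ Y₂ A₂ B₂ : Type*}
  [MeasurableSpace X₁] [MeasurableSpace Y₁] [MeasurableSpace A₁] [MeasurableSpace B₁]
  [MeasurableSpace X₂] [MeasurableSpace Y₂] [MeasurableSpace A₂] [MeasurableSpace B₂]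
  {p₁ : NSCorrelation X₁ Y₁ A₁ B₁} {p₂ : NSCorrelation X₂ Y₂ A₂ B₂}
  {p : NSCorrelation (X₁ × X₂) (Y₁ × Y₂) (A₁ × A₂) (B₁ × B₂)}

theorem IsCorrelationProduct.isVectorState {H K : Type*} [NormedAddCommGroup H]
    [InnerProductSpace ℂ H] [CompleteSpace H] [NormedAddCommGroup K] [InnerProductSpace ℂ K]
    [CompleteSpace K] (h : IsCorrelationProduct p₁ p₂ p) {G₁ : X₁ × Y₁ → QPM (A₁ × B₁) H}
    {G₂ : X₂ × Y₂ → QPM (A₂ × B₂) K} {ξ₁ : H} {ξ₂ : K} (h₁ : p₁.IsVectorState G₁ ξ₁)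
    (h₂ : p₂.IsVectorState G₂ ξ₂) :
    p.IsVectorState (fun z => ((G₁ (z.1.1, z.2.1)).prod (G₂ (z.1.2, z.2.2))).map
      measurable_middleSwap) ((ξ₁ ⊗ₜ[ℂ] ξ₂ : H ⊗[ℂ] K) : HilbertTensor H K) := by
  rintro ⟨x₁, x₂⟩ ⟨y₁, y₂⟩ L hL
  rw [h.kernel_apply, map_measureReal_apply measurable_middleSwap hL]
  exact real_prod_eq_inner_tmul (h₁ x₁ y₁) (h₂ x₂ y₂) (measurable_middleSwap hL)

theorem IsCorrelationProduct.isQuantumCommuting (h : IsCorrelationProduct p₁ p₂ p)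
    (h₁ : p₁.IsQuantumCommuting.{v}) (h₂ : p₂.IsQuantumCommuting.{v}) :
    p.IsQuantumCommuting.{v} := by
  obtain ⟨H₁, _, _, _, E₁, F₁, G₁, ξ₁, -, hG₁, hξ₁, hp₁⟩ := h₁
  obtain ⟨H₂, _, _, _, E₂, F₂, G₂, ξ₂, -, hG₂, hξ₂, hp₂⟩ := h₂
  let G : (X₁ × X₂) × (Y₁ × Y₂) → QPM ((A₁ × A₂) × (B₁ × B₂)) (HilbertTensor H₁ H₂) := fun z =>
    ((G₁ (z.1.1, z.2.1)).prod (G₂ (z.1.2, z.2.2))).map measurable_middleSwap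
  have hG : IsDotProduct (E₁.prod E₂) (F₁.prod F₂) G := by
    rintro ⟨x₁, x₂⟩ ⟨y₁, y₂⟩ s t hs ht
    refine QPM.apply_prod_eq_mul (fun α α' β β' hα hα' hβ hβ' => ?_) hs ht
    rw [QPM.map_apply, middleSwap_preimage_prod, QPM.prod_prod _ _ (hα.prod hβ) (hα'.prod hβ'),
      hG₁ x₁ y₁ α β hα hβ, hG₂ x₂ y₂ α' β' hα' hβ', opTensor_mul, OpChannel.prod_apply,
      OpChannel.prod_apply, QPM.prod_prod _ _ hα hα', QPM.prod_prod _ _ hβ hβ']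
  refine ⟨HilbertTensor H₁ H₂, inferInstance, inferInstance, inferInstance, E₁.prod E₂,
    F₁.prod F₂, G, _, fun x y α β hα hβ => ?_, hG, norm_coe_tmul hξ₁ hξ₂,
    h.isVectorState hp₁ hp₂⟩
  -- Commutation comes from positivity: the product of the two operators is a value of `G`.
  refine commute_of_isPositive_mul ((E₁.prod E₂ x).isPositive α hα)
    ((F₁.prod F₂ y).isPositive β hβ) ?_
  rw [← hG x y α β hα hβ]
  exact (G (x, y)).isPositive _ (hα.prod hβ)

theorem IsCorrelationProduct.isQuantumSpatial (h : IsCorrelationProduct p₁ p₂ p)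
    (h₁ : p₁.IsQuantumSpatial.{v}) (h₂ : p₂.IsQuantumSpatial.{v}) :
    p.IsQuantumSpatial.{v} := by
  obtain ⟨H₁, _, _, _, K₁, _, _, _, E₁, F₁, G₁, ξ₁, hG₁, hξ₁, hp₁⟩ := h₁
  obtain ⟨H₂, _, _, _, K₂, _, _, _, E₂, F₂, G₂, ξ₂, hG₂, hξ₂, hp₂⟩ := h₂
  let ζ : HilbertTensor (HilbertTensor H₁ K₁) (HilbertTensor H₂ K₂) :=
    (ξ₁ ⊗ₜ[ℂ] ξ₂ : HilbertTensor H₁ K₁ ⊗[ℂ] HilbertTensor H₂ K₂)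
  refine ⟨HilbertTensor H₁ H₂, inferInstance, inferInstance, inferInstance,
    HilbertTensor K₁ K₂, inferInstance, inferInstance, inferInstance, E₁.prod E₂, F₁.prod F₂,
    fun z => (E₁.prod E₂ z.1).prod (F₁.prod F₂ z.2), interchange H₁ K₁ H₂ K₂ ζ,
    fun x y α β hα hβ => QPM.prod_prod _ _ hα hβ,
    (norm_interchange ζ).trans (norm_coe_tmul hξ₁ hξ₂), ?_⟩
  rintro ⟨x₁, x₂⟩ ⟨y₁, y₂⟩ L hL
  -- The two scalar measures agree on rectangles of rectangles because the interchange intertwines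
  -- the corresponding operators; there they determine each other.
  have he : ((E₁.prod E₂ (x₁, x₂)).prod (F₁.prod F₂ (y₁, y₂))).complexMeasure
      (interchange H₁ K₁ H₂ K₂ ζ) (interchange H₁ K₁ H₂ K₂ ζ) =
      (((G₁ (x₁, y₁)).prod (G₂ (x₂, y₂))).map measurable_middleSwap).complexMeasure ζ ζ :=
    complexMeasure_ext_prod_prod fun α α' β β' hα hα' hβ hβ' => by
      rw [QPM.complexMeasure_apply _ _ _ ((hα.prod hα').prod (hβ.prod hβ')),
        QPM.complexMeasure_apply _ _ _ ((hα.prod hα').prod (hβ.prod hβ')),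
        QPM.map_apply, middleSwap_preimage_prod, QPM.prod_prod _ _ (hα.prod hβ) (hα'.prod hβ'),
        QPM.prod_prod _ _ (hα.prod hα') (hβ.prod hβ'), hG₁ x₁ y₁ α β hα hβ,
        hG₂ x₂ y₂ α' β' hα' hβ', OpChannel.prod_apply, OpChannel.prod_apply,
        QPM.prod_prod _ _ hα hα', QPM.prod_prod _ _ hβ hβ', inner_interchange]
  refine (h.isVectorState hp₁ hp₂ (x₁, x₂) (y₁, y₂) L hL).trans ?_
  refine (QPM.complexMeasure_apply _ ζ ζ hL).symm.trans ?_
  rw [← QPM.complexMeasure_apply _ _ _ hL, he]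

end Correlation

end MeasurableNS

end

theorem theorem5p4
    {X₁ Y₁ A₁ B₁ X₂ Y₂ A₂ B₂ : Type*}
    [TopologicalSpace X₁] [CompactSpace X₁] [T2Space X₁] [SecondCountableTopology X₁]
    [MeasurableSpace X₁] [BorelSpace X₁]
    [TopologicalSpace Y₁] [CompactSpace Y₁] [T2Space Y₁] [SecondCountableTopology Y₁]
    [MeasurableSpace Y₁] [BorelSpace Y₁]
    [TopologicalSpace A₁] [CompactSpace A₁] [T2Space A₁] [SecondCountableTopology A₁]
    [MeasurableSpace A₁] [BorelSpace A₁]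
    [TopologicalSpace B₁] [CompactSpace B₁] [T2Space B₁] [SecondCountableTopology B₁]
    [MeasurableSpace B₁] [BorelSpace B₁]
    [TopologicalSpace X₂] [CompactSpace X₂] [T2Space X₂] [SecondCountableTopology X₂]
    [MeasurableSpace X₂] [BorelSpace X₂]
    [TopologicalSpace Y₂] [CompactSpace Y₂] [T2Space Y₂] [SecondCountableTopology Y₂]
    [MeasurableSpace Y₂] [BorelSpace Y₂]
    [TopologicalSpace A₂] [CompactSpace A₂] [T2Space A₂] [SecondCountableTopology A₂]
    [MeasurableSpace A₂] [BorelSpace A₂]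
    [TopologicalSpace B₂] [CompactSpace B₂] [T2Space B₂] [SecondCountableTopology B₂]
    [MeasurableSpace B₂] [BorelSpace B₂]
    (p₁ : MeasurableNS.NSCorrelation X₁ Y₁ A₁ B₁) (p₂ : MeasurableNS.NSCorrelation X₂ Y₂ A₂ B₂) :
    (∃! p : MeasurableNS.NSCorrelation (X₁ × X₂) (Y₁ × Y₂) (A₁ × A₂) (B₁ × B₂),
      MeasurableNS.IsCorrelationProduct p₁ p₂ p) ∧
    ∀ p : MeasurableNS.NSCorrelation (X₁ × X₂) (Y₁ × Y₂) (A₁ × A₂) (B₁ × B₂),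
      MeasurableNS.IsCorrelationProduct p₁ p₂ p →
        (p₁.IsLocal → p₂.IsLocal → p.IsLocal) ∧
        (p₁.IsQuantumSpatial.{v} → p₂.IsQuantumSpatial.{v} → p.IsQuantumSpatial.{v}) ∧
        (p₁.IsQuantumCommuting.{v} → p₂.IsQuantumCommuting.{v} → p.IsQuantumCommuting.{v}) := by
  refine ⟨⟨MeasurableNS.NSCorrelation.tensor p₁ p₂, MeasurableNS.isCorrelationProduct_tensor,
    fun p hp => hp.unique MeasurableNS.isCorrelationProduct_tensor⟩, fun p hp => ⟨?_, ?_, ?_⟩⟩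
  · exact hp.isLocal
  · exact hp.isQuantumSpatial
  · exact hp.isQuantumCommuting
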